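/- **Setting.** Let $n\ge 0$, let $K$ be a field, $q\in K$, and let $y_1,\dots,y_n\in K$ be nonzero and pairwise distinct (for instance $q,y_1,\dots,y_n$ indeterminates and $K$ the field of rational functions in them). Let $S_n$ act on type A roots by $w(e_a-e_b)=e_{w(a)}-e_{w(b)}$; the root $e_a-e_b$ is positive if $a<b$, $\alpha_i=e_i-e_{i+1}$, $s_i=(i\ i{+}1)$, $\boldsymbol y^{e_a-e_b}=y_a/y_b$, and $\ell$ and $\le$ are the length and the Bruhat order of $S_n$. **The functions $r_{u,v}$.** The Bump–Nakasuji deformed Kazhdan–Lusztig $R$-polynomials are the family $r_{u,v}\in K$ ($u,v\in S_n$) such that $r_{u,v}=0$ unless $u\le v$, $r_{v,v}=1$, and for every simple reflection $s=s_i$ with $sv<v$, with $\beta=-v^{-1}(\alpha_i)$, $$r_{u,v}=\begin{cases}\dfrac{1-q}{1-\boldsymbol y^{\beta}}\,r_{u,sv}+r_{su,sv}& su<u,\\[2mm](1-q)\dfrac{\boldsymbol y^{\beta}}{1-\boldsymbol y^{\beta}}\,r_{u,sv}+q\,r_{su,sv}& su>u.\end{cases}$$ For $w,u,v\in S_n$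 put $$\phi_w=\prod_{\alpha>0,\ w^{-1}\alpha>0}(q\boldsymbol y^{-\alpha}-1)\prod_{\alpha>0,\ w^{-1}\alpha<0}(1-\boldsymbol y^{-\alpha}),\qquad [\Theta_u]_v=\phi_v\,r_{u^{-1},v^{-1}}.$$ **The lattice model.** Consider the $n\times n$ grid with rows numbered from top to bottom and columns from right to left. A state labels each horizontal edge by an element of $\{+,1,\dots,n\}$ and each vertical edge by a subset of $\{1,\dots,n\}$. A vertex with left, top, right, bottom labels $(l,\Sigma,r,B)$ has a Boltzmann weight depending on $q$ and a parameter $z$. Write $\Sigma_{>c}=|\{e\in\Sigma:e>c\}|$, and similarly $\Sigma_{<c}$, $\Sigma_{(c,d)}$ for the numbers of elements of $\Sigma$ less than $c$, respectively strictly between $c$ and $d$, and let $\Sigma_c$ be $1$ if $c\in\Sigma$ and $0$ otherwise. The weights are: 1. $(+,\Sigma,+,\Sigma)$: $(-q)^{|\Sigma|}$; 2. $(c,\Sigma,c,\Sigma)$: $q^{\Sigma_{>c}}(-z+q^{\Sigma_c})$; 3. $(+,\Sigma,c,\Sigma\setminus\{c\})$ with $c\in\Sigma$: $(-q)^{\Sigma_{<c}}q^{\Sigma_{>c}}$;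 4. $(c,\Sigma,+,\Sigma\cup\{c\})$ with $c\notin\Sigma$: $(q-1)\,z\,(-q)^{\Sigma_{>c}}$; 5. $(c,\Sigma,d,(\Sigma\cup\{c\})\setminus\{d\})$ with $c<d$, $c\notin\Sigma$, $d\in\Sigma$: $(q-1)\,z\,(-q)^{\Sigma_{(c,d)}}q^{\Sigma_{>d}}$; 6. $(d,\Sigma,c,(\Sigma\cup\{d\})\setminus\{c\})$ with $c<d$, $d\notin\Sigma$, $c\in\Sigma$: $(q-1)(-1)^{\Sigma_{(c,d)}}q^{\Sigma_{>d}}$; and all other vertex configurations have weight $0$. For $\sigma,w\in S_n$, let $Z^\square_{\sigma,w}(\boldsymbol x;\boldsymbol y)$ be the sum, over all states whose top boundary edge in column $j$ carries $\{\sigma(j)\}$, whose right boundary edge in row $i$ carries $w(i)$, and whose left and bottom boundary edges carry no color, of the product of the weights of all vertices, where the vertex in row $i$ and column $j$ has $z=x_i/y_j$. Put $Z^\square_{\sigma,w}|_v=Z^\square_{\sigma,w}(y_{v(1)},\dots,y_{v(n)};y_1,\dots,y_n)$. **Statement.** (0) There is exactly one family $(r_{u,v})$ with the properties above. (1) For all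 $u,v\in S_n$, $\;Z^\square_{1,u}|_v=[\Theta_u]_v$. (2) If moreover $q\,y_j\ne y_i$ for all $i<j$, then for all $u,v\in S_n$ one has $\phi_{v^{-1}}\neq0$ and $$r_{u,v}=\phi_{v^{-1}}^{-1}\,Z^\square_{1,u^{-1}}|_{v^{-1}}.$$ (3) For all $u,v\in S_n$, $Z^\square_{1,u^{-1}}|_{v^{-1}}$ is the partition function of the above model with top boundary given by the identity and right boundary given by $u^{-1}$, in which the vertex in row $i$ and column $j$ has the weights 1–6 with $z=\boldsymbol y^{\alpha}$, $\alpha=e_{v^{-1}(i)}-e_j$. -/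

import Mathlib

namespace ColoredLattice

/-! ### The symmetric group as the Weyl group of type A

`Equiv.Perm (Fin n)` is the symmetric group, with product `(u * v) k = u (v k)`. A root of type A is
a vector `e a - e b` with `a ≠ b`; it is positive when `a < b`; a permutation `w` maps it to
`e (w a) - e (w b)`. The simple roots are `e i - e (i + 1)`. -/

section SymmetricGroup

variable {n : ℕ}

/-- The first index `i` of the simple root `α_i = e i - e (i + 1)`. -/
def lo (i : Fin (n - 1)) : Fin n := ⟨i, by have := i.isLt; omega⟩

/-- The second index `i + 1` of the simple root `α_i = e i - e (i + 1)`. -/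
def hi (i : Fin (n - 1)) : Fin n := ⟨i + 1, by have := i.isLt; omega⟩

/-- The simple reflection `s_i`, which exchanges `i` and `i + 1`. -/
def simpleRefl (i : Fin (n - 1)) : Equiv.Perm (Fin n) := Equiv.swap (lo i) (hi i)

/-- The Coxeter length of a permutation: its number of inversions. -/
def len (w : Equiv.Perm (Fin n)) : ℕ :=
  (Finset.univ.filter fun p : Fin n × Fin n => p.1 < p.2 ∧ w p.2 < w p.1).card

/-- The (strong) Bruhat order: `u ≤ v` when `v` is reached from `u` by a chain of right
multiplications by reflections, each of which increases the length. -/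
def BruhatLE (u v : Equiv.Perm (Fin n)) : Prop :=
  Relation.ReflTransGen
    (fun a b : Equiv.Perm (Fin n) => ∃ i j : Fin n, i ≠ j ∧ b = a * Equiv.swap i j ∧ len a < len b)
    u v

end SymmetricGroup

section Functions

variable {n : ℕ} {K : Type*} [Field K]

/-- The value `y^α = y_a / y_b` of the character `α = e a - e b` at the point `y` of the torus. -/
def rootVal (y : Fin n → K) (a b : Fin n) : K := y a / y b

/-! ### The deformed Kazhdan–Lusztig R-polynomials -/

/-- The number `y^β` for `β = - v⁻¹ α_i = e (v⁻¹ (i + 1)) - e (v⁻¹ i)`. -/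
def betaVal (y : Fin n → K) (v : Equiv.Perm (Fin n)) (i : Fin (n - 1)) : K :=
  rootVal y (v⁻¹ (hi i)) (v⁻¹ (lo i))

/-- The characterization of the Bump–Nakasuji functions `r u v`: they vanish unless `u ≤ v` in the
Bruhat order, they are `1` for `u = v`, and they obey the recursion for *every* simple reflection
`s` with `s v < v`. -/
structure IsBumpNakasuji (q : K) (y : Fin n → K)
    (r : Equiv.Perm (Fin n) → Equiv.Perm (Fin n) → K) : Prop where
  vanish : ∀ u v, ¬ BruhatLE u v → r u v = 0
  diag : ∀ v, r v v = 1
  rec_descent : ∀ (u v : Equiv.Perm (Fin n)) (i : Fin (n - 1)),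
    len (simpleRefl i * v) < len v → len (simpleRefl i * u) < len u →
    r u v = (1 - q) / (1 - betaVal y v i) * r u (simpleRefl i * v)
      + r (simpleRefl i * u) (simpleRefl i * v)
  rec_ascent : ∀ (u v : Equiv.Perm (Fin n)) (i : Fin (n - 1)),
    len (simpleRefl i * v) < len v → len u < len (simpleRefl i * u) →
    r u v = (1 - q) * (betaVal y v i / (1 - betaVal y v i)) * r u (simpleRefl i * v)
      + q * r (simpleRefl i * u) (simpleRefl i * v)

open Classical in
/-- The Bump–Nakasuji functions `r_{u,v}(y)`, with deformation parameter `q`, built by the recursion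
along one chosen left descent of `v`; a `v` without left descents is the identity. -/
noncomputable def rPoly (q : K) (y : Fin n → K) (u v : Equiv.Perm (Fin n)) : K :=
  if h : ∃ i : Fin (n - 1), len (simpleRefl i * v) < len v then
    if len (simpleRefl h.choose * u) < len u then
      (1 - q) / (1 - betaVal y v h.choose) * rPoly q y u (simpleRefl h.choose * v)
        + rPoly q y (simpleRefl h.choose * u) (simpleRefl h.choose * v)
    else
      (1 - q) * (betaVal y v h.choose / (1 - betaVal y v h.choose))
          * rPoly q y u (simpleRefl h.choose * v)
        + q * rPoly q y (simpleRefl h.choose * u) (simpleRefl h.choose * v)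
  else if u = v then 1 else 0
termination_by len v
decreasing_by all_goals exact h.choose_spec

/-- `φ_w(y)`: the product, over the positive roots `α = e a - e b`, of `q y^{-α} - 1` when `w⁻¹ α`
is positive and of `1 - y^{-α}` when `w⁻¹ α` is negative. -/
def phi (q : K) (y : Fin n → K) (w : Equiv.Perm (Fin n)) : K :=
  (∏ p : Fin n × Fin n with p.1 < p.2 ∧ w⁻¹ p.1 < w⁻¹ p.2, (q * (rootVal y p.1 p.2)⁻¹ - 1))
    * ∏ p : Fin n × Fin n with p.1 < p.2 ∧ w⁻¹ p.2 < w⁻¹ p.1, (1 - (rootVal y p.1 p.2)⁻¹)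

/-- `[Θ_u]_v = φ_v r_{u⁻¹, v⁻¹}`. -/
noncomputable def theta (q : K) (y : Fin n → K) (u v : Equiv.Perm (Fin n)) : K :=
  phi q y v * rPoly q y u⁻¹ v⁻¹

/-! ### Boltzmann weights

The colors are the elements of `Fin n`. A horizontal edge carries a color (`some c`) or none
(`none`, the label `+`); a vertical edge carries a set of colors. The arguments of a weight are the
labels of the left, top, right and bottom edges of the vertex. A configuration that is not one of
the six admissible cases gets the weight `0`. -/

/-- The K-theoretic weight of a vertex with row parameter `x` and column parameter `y`. -/
def kWeight (t x y : K) (l : Option (Fin n)) (S : Finset (Fin n)) (r : Option (Fin n))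
    (B : Finset (Fin n)) : K :=
  match l, r with
  -- Case 1
  | none, none => if B = S then (-t) ^ S.card else 0
  -- Case 3
  | none, some c =>
      if c ∈ S ∧ B = S.erase c then
        (-t) ^ (S.filter (· < c)).card * t ^ (S.filter (c < ·)).card
      else 0
  -- Case 4
  | some c, none =>
      if c ∉ S ∧ B = insert c S then (t - 1) * (x * y⁻¹) * (-t) ^ (S.filter (c < ·)).card else 0
  | some a, some b =>
      if a = b then
        -- Case 2
        if B = S then
          t ^ (S.filter (a < ·)).card * (-(x * y⁻¹) + t ^ (S.filter (· = a)).card)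
        else 0
      else if a ∉ S ∧ b ∈ S ∧ B = (insert a S).erase b then
        if a < b then
          -- Case 5
          (t - 1) * (x * y⁻¹) * (-t) ^ (S.filter fun e => a < e ∧ e < b).card
            * t ^ (S.filter (b < ·)).card
        else
          -- Case 6
          (t - 1) * (-1) ^ (S.filter fun e => b < e ∧ e < a).card * t ^ (S.filter (a < ·)).card
      else 0

/-- The weight of a vertex of the lattice model for `r_{u,v}`, in terms of `q` and of the value
`z = y^α` of the root (or zero vector) `α` that belongs to the vertex. -/
def rWeight (q z : K) (l : Option (Fin n)) (S : Finset (Fin n)) (r : Option (Fin n))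
    (B : Finset (Fin n)) : K :=
  match l, r with
  -- Case 1
  | none, none => if B = S then (-q) ^ S.card else 0
  -- Case 3
  | none, some c =>
      if c ∈ S ∧ B = S.erase c then
        (-q) ^ (S.filter (· < c)).card * q ^ (S.filter (c < ·)).card
      else 0
  -- Case 4
  | some c, none =>
      if c ∉ S ∧ B = insert c S then (q - 1) * z * (-q) ^ (S.filter (c < ·)).card else 0
  | some a, some b =>
      if a = b then
        -- Case 2
        if B = S then q ^ (S.filter (a < ·)).card * (-z + q ^ (S.filter (· = a)).card) else 0
      else if a ∉ S ∧ b ∈ S ∧ B = (insert a S).erase b then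
        if a < b then
          -- Case 5
          (q - 1) * z * (-q) ^ (S.filter fun e => a < e ∧ e < b).card
            * q ^ (S.filter (b < ·)).card
        else
          -- Case 6
          (q - 1) * (-1) ^ (S.filter fun e => b < e ∧ e < a).card * q ^ (S.filter (a < ·)).card
      else 0

/-! ### The square lattice model and its partition function -/

/-- A decoration of the edges of the `n × n` grid. Rows are numbered from top to bottom and columns
from right to left. `s.1 i k` is the label of a horizontal edge in row `i`: the vertex in row `i`
and column `j` has right edge `k = j` and left edge `k = j + 1`, so `k = 0` is the right boundary
and `k = n` the left boundary. `s.2 k j` is the label of a vertical edge in column `j`: the vertex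
in row `i` has top edge `k = i` and bottom edge `k = i + 1`. -/
abbrev State (n : ℕ) : Type :=
  (Fin n → Fin (n + 1) → Option (Fin n)) × (Fin (n + 1) → Fin n → Finset (Fin n))

/-- The boundary conditions `B(σ, w, □)` with `□ = (n, n-1, …, 1)`: the top edge of column `j`
carries the single color `σ j`, the right edge of row `i` carries the color `w i`, and the left and
bottom boundary edges are uncolored. -/
def HasBoundary (σ w : Equiv.Perm (Fin n)) (s : State n) : Prop :=
  (∀ j, s.2 0 j = {σ j}) ∧ (∀ i, s.1 i 0 = some (w i)) ∧
    (∀ i, s.1 i (Fin.last n) = none) ∧ (∀ j, s.2 (Fin.last n) j = ∅)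

open Classical in
/-- The partition function with boundary conditions `B(σ, w, □)`, where `W i j` is the Boltzmann
weight of the vertex in row `i` and column `j`: the sum over the states of the product of the
weights of all vertices (states with a vertex that is not admissible contribute `0`). -/
noncomputable def partitionFunction
    (W : Fin n → Fin n → Option (Fin n) → Finset (Fin n) → Option (Fin n) → Finset (Fin n) → K)
    (σ w : Equiv.Perm (Fin n)) : K :=
  ∑ s : State n with HasBoundary σ w s,
    ∏ i, ∏ j, W i j (s.1 i j.succ) (s.2 i.castSucc j) (s.1 i j.castSucc) (s.2 i.succ j)

/-- `Z^□_{σ,w}(x; y)`, with deformation parameter `t`. -/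
noncomputable def Zsq (t : K) (σ w : Equiv.Perm (Fin n)) (x y : Fin n → K) : K :=
  partitionFunction (fun i j => kWeight t (x i) (y j)) σ w

/-- The restriction `f|_u (y) = f(y_{u(1)}, …, y_{u(n)}; y_1, …, y_n)`. -/
def restrict (f : (Fin n → K) → (Fin n → K) → K) (u : Equiv.Perm (Fin n)) (y : Fin n → K) : K :=
  f (fun i => y (u i)) y

end Functions

end ColoredLattice

open ColoredLattice

/-! The identity `Z_{1,u}|_v = [Θ_u]_v` holds because both sides obey the same exchange relation
under a simple reflection and agree when `u` is the longest permutation `w₀`.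

Let `s = s_i` and `u(i+1) < u(i)`. In the row parameters `x` the relation is `(x_{i+1} - q x_i)
Z_u(x) = (1-q) x_i Z_u(s x) + (x_i - x_{i+1}) Z_{us}(s x)` (`Zsq_relation`). It is a Yang–Baxter
argument: an R-matrix attached on the left of rows `i`, `i+1` meets two uncolored edges and acts
there as the scalar `x_{i+1} - q x_i`; pushed through all columns (`rowPair_yangBaxter`), it
exchanges the row parameters and keeps or exchanges the two boundary colors on the right. For `x = y
∘ v`, the same relation for `Θ` comes from the recursion for `r`, because `φ_v` and `φ_{vs}` differ
in a single factor (`theta_relation`). As the `y_j` are distinct, the coefficient of the `us` term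
is nonzero, so the values at `u` determine those at `us`, and induction descends from `w₀`
(`restrict_Zsq`).

For `w₀` at most one state contributes, and `Z` is an explicit product of factors `1 - x_i/y_j`
(`Zsq_rev`). Its restriction to `v ≠ w₀` contains a zero factor, while `r_{w₀,v⁻¹} = 0` by length;
at `v = w₀` the product is `φ_{w₀}`.

The family `r` is well defined because the recursion does not depend on the descent chosen: the
recursion operators satisfy a commutation and a parametrized braid relation (`recOp_comm`,
`recOp_braid`, `rPoly_eq_recOp`). Its support lies in the Bruhat order by a lifting property
(`BruhatLE.lift`). -/

namespace ColoredLattice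

/-! ### Length, descents and the Bruhat order -/

section Length

variable {n : ℕ}

theorem lo_ne_hi (i : Fin (n - 1)) : lo i ≠ hi i := by
  simp [lo, hi, Fin.ext_iff]

theorem lo_lt_hi (i : Fin (n - 1)) : lo i < hi i := by
  simp [lo, hi, Fin.lt_def]

theorem simpleRefl_lo (i : Fin (n - 1)) : simpleRefl i (lo i) = hi i := Equiv.swap_apply_left _ _

theorem simpleRefl_hi (i : Fin (n - 1)) : simpleRefl i (hi i) = lo i := Equiv.swap_apply_right _ _

theorem simpleRefl_mul_self (i : Fin (n - 1)) : simpleRefl i * simpleRefl i = 1 :=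
  Equiv.swap_mul_self _ _

theorem simpleRefl_mul_cancel (i : Fin (n - 1)) (u : Equiv.Perm (Fin n)) :
    simpleRefl i * (simpleRefl i * u) = u := by
  rw [← mul_assoc, simpleRefl_mul_self, one_mul]

theorem simpleRefl_inv (i : Fin (n - 1)) : (simpleRefl i)⁻¹ = simpleRefl i := Equiv.swap_inv _ _

theorem simpleRefl_far {i j : Fin (n - 1)} (hij : (i : ℕ) + 1 < j) :
    simpleRefl j (lo i) = lo i ∧ simpleRefl j (hi i) = hi i ∧ simpleRefl i (lo j) = lo j
      ∧ simpleRefl i (hi j) = hi j := by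
  refine ⟨?_, ?_, ?_, ?_⟩ <;> apply Equiv.swap_apply_of_ne_of_ne <;>
    simp only [lo, hi, Ne, Fin.ext_iff] <;> omega

theorem simpleRefl_comm {i j : Fin (n - 1)} (hij : (i : ℕ) + 1 < j) (u : Equiv.Perm (Fin n)) :
    simpleRefl i * (simpleRefl j * u) = simpleRefl j * (simpleRefl i * u) := by
  obtain ⟨h1, h2, -, -⟩ := simpleRefl_far hij
  rw [← mul_assoc, ← mul_assoc]
  congr 1
  rw [simpleRefl, Equiv.swap_mul_eq_mul_swap]
  simp only [simpleRefl_inv, h1, h2]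

theorem simpleRefl_adjacent {i j : Fin (n - 1)} (hij : (i : ℕ) + 1 = j) :
    lo j = hi i ∧ lo i ≠ hi j ∧ simpleRefl i (hi j) = hi j ∧ simpleRefl j (lo i) = lo i
      ∧ simpleRefl j (hi i) = hi j ∧ simpleRefl j (hi j) = hi i := by
  have h1 : lo j = hi i := by simp [lo, hi, hij]
  refine ⟨h1, ?_, ?_, ?_, ?_, ?_⟩
  · simp only [lo, hi, Ne, Fin.ext_iff]; omega
  · apply Equiv.swap_apply_of_ne_of_ne <;> simp only [lo, hi, Ne, Fin.ext_iff] <;> omega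
  · apply Equiv.swap_apply_of_ne_of_ne <;> simp only [lo, hi, Ne, Fin.ext_iff] <;> omega
  · rw [← h1, simpleRefl_lo]
  · rw [simpleRefl_hi, h1]

theorem simpleRefl_braid {i j : Fin (n - 1)} (hij : (i : ℕ) + 1 = j) (u : Equiv.Perm (Fin n)) :
    simpleRefl i * (simpleRefl j * (simpleRefl i * u))
      = simpleRefl j * (simpleRefl i * (simpleRefl j * u)) := by
  obtain ⟨hlo, -, e1, e2, e3, -⟩ := simpleRefl_adjacent hij
  simp only [← mul_assoc]
  congr 1
  have h1 : simpleRefl i * simpleRefl j * simpleRefl i = Equiv.swap (lo i) (hi j) := by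
    rw [simpleRefl.eq_1 j, Equiv.mul_swap_eq_swap_mul, mul_assoc, simpleRefl_mul_self, mul_one,
      hlo, simpleRefl_hi, e1]
  have h2 : simpleRefl j * simpleRefl i * simpleRefl j = Equiv.swap (lo i) (hi j) := by
    rw [simpleRefl.eq_1 i, Equiv.mul_swap_eq_swap_mul, mul_assoc, simpleRefl_mul_self, mul_one,
      e2, e3]
  rw [h1, h2]

theorem inv_simpleRefl_mul (i : Fin (n - 1)) (u : Equiv.Perm (Fin n)) (k : Fin n) :
    (simpleRefl i * u)⁻¹ k = u⁻¹ (simpleRefl i k) := by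
  rw [mul_inv_rev, simpleRefl_inv, Equiv.Perm.mul_apply]

theorem simpleRefl_lt_iff (i : Fin (n - 1)) {a b : Fin n} (h : ¬ (a = lo i ∧ b = hi i))
    (h' : ¬ (a = hi i ∧ b = lo i)) : simpleRefl i a < simpleRefl i b ↔ a < b := by
  simp only [simpleRefl, Equiv.swap_apply_def, lo, hi, Fin.ext_iff] at *
  split_ifs <;> simp only [Fin.lt_def] <;> omega

/-- The inversions of `a` inject into those of the product, and the new inversion `(i, j)` is not in
the image. -/
theorem len_lt_len_mul_swap (a : Equiv.Perm (Fin n)) {i j : Fin n} (hij : i < j) (h : a i < a j) :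
    len a < len (a * Equiv.swap i j) := by
  classical
  set σ := Equiv.swap i j with hσ
  have hσσ : ∀ k, σ (σ k) = k := fun k => Equiv.swap_apply_self _ _ _
  have hmid : ∀ p q, p < q → σ q < σ p →
      (p = i ∧ q = j) ∨ (p = i ∧ i < q ∧ q < j) ∨ (q = j ∧ i < p ∧ p < j) := by
    intro p q hpq
    rw [hσ, Equiv.swap_apply_def, Equiv.swap_apply_def]
    split_ifs <;> simp only [Fin.lt_def, Fin.ext_iff] at * <;> omega
  have hk : ∀ k, i < k → k < j → σ k = k := fun k h1 h2 =>
    Equiv.swap_apply_of_ne_of_ne h1.ne' h2.ne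
  have hi : σ i = j := Equiv.swap_apply_left _ _
  have hj : σ j = i := Equiv.swap_apply_right _ _
  -- The transposition is applied to a pair when it keeps the pair in order. The pairs it would
  -- reverse are listed in `hmid`; those that are inversions of `a` stay inversions of the product.
  let f : Fin n × Fin n → Fin n × Fin n := fun p =>
    if σ p.1 < σ p.2 then (σ p.1, σ p.2) else p
  unfold len
  rw [← Finset.card_image_of_injOn (f := f) (s := Finset.univ.filter fun p : Fin n × Fin n =>
    p.1 < p.2 ∧ a p.2 < a p.1)]
  · apply Finset.card_lt_card
    rw [Finset.ssubset_iff_of_subset]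
    · refine ⟨(i, j), ?_, ?_⟩
      · exact Finset.mem_filter.2 ⟨Finset.mem_univ _, hij, by
          simpa only [Equiv.Perm.mul_apply, hi, hj] using h⟩
      · simp only [Finset.mem_image, Finset.mem_filter, Finset.mem_univ, true_and, not_exists,
          not_and, Prod.forall]
        intro p q hpq hf
        simp only [f] at hf
        split_ifs at hf with h1
        · simp only [Prod.mk.injEq] at hf
          have e1 : p = j := by rw [← hσσ p, hf.1, hi]
          have e2 : q = i := by rw [← hσσ q, hf.2, hj]
          rw [e1, e2] at hpq
          exact absurd hpq.1 hij.not_gt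
        · simp only [Prod.mk.injEq] at hf
          rw [hf.1, hf.2] at hpq
          exact absurd hpq.2 h.not_gt
    · intro p hp
      simp only [Finset.mem_image, Finset.mem_filter, Finset.mem_univ, true_and, Prod.exists] at hp ⊢
      obtain ⟨p, q, ⟨hpq, ha⟩, rfl⟩ := hp
      simp only [f]
      split_ifs with h1
      · exact ⟨h1, by simpa only [Equiv.Perm.mul_apply, hσσ] using ha⟩
      · refine ⟨hpq, ?_⟩
        have h2 : σ q < σ p := lt_of_le_of_ne (not_lt.1 h1) fun h' => hpq.ne' (σ.injective h')
        simp only [Equiv.Perm.mul_apply]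
        rcases hmid p q hpq h2 with ⟨rfl, rfl⟩ | ⟨rfl, h3, h4⟩ | ⟨rfl, h3, h4⟩
        · exact absurd ha h.not_gt
        · rw [hi, hk q h3 h4]; exact ha.trans h
        · rw [hj, hk p h3 h4]; exact h.trans ha
  · rintro ⟨p, q⟩ hp ⟨p', q'⟩ hp' hf
    simp only [Finset.coe_filter, Finset.mem_univ, true_and, Set.mem_ofPred_eq] at hp hp'
    simp only [f] at hf
    split_ifs at hf with h1 h2 h2
    · simp only [Prod.mk.injEq, σ.injective.eq_iff] at hf
      rw [hf.1, hf.2]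
    · simp only [Prod.mk.injEq] at hf
      rw [← hf.1, ← hf.2, hσσ, hσσ] at h2
      exact absurd hp.1 h2
    · simp only [Prod.mk.injEq] at hf
      rw [hf.1, hf.2, hσσ, hσσ] at h1
      exact absurd hp'.1 h1
    · exact hf

theorem simpleRefl_mul_eq (i : Fin (n - 1)) (v : Equiv.Perm (Fin n)) :
    simpleRefl i * v = v * Equiv.swap (v⁻¹ (lo i)) (v⁻¹ (hi i)) := by
  rw [Equiv.mul_swap_eq_swap_mul]
  simp [simpleRefl]

theorem len_lt_of_inv_lt (i : Fin (n - 1)) (v : Equiv.Perm (Fin n))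
    (h : v⁻¹ (lo i) < v⁻¹ (hi i)) : len v < len (simpleRefl i * v) := by
  rw [simpleRefl_mul_eq]
  exact len_lt_len_mul_swap v h (by simpa using lo_lt_hi i)

theorem len_gt_of_inv_gt (i : Fin (n - 1)) (v : Equiv.Perm (Fin n))
    (h : v⁻¹ (hi i) < v⁻¹ (lo i)) : len (simpleRefl i * v) < len v := by
  have := len_lt_of_inv_lt i (simpleRefl i * v)
    (by rwa [inv_simpleRefl_mul, inv_simpleRefl_mul, simpleRefl_lo, simpleRefl_hi])
  rwa [simpleRefl_mul_cancel] at this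

theorem len_simpleRefl_mul_lt_iff (i : Fin (n - 1)) (v : Equiv.Perm (Fin n)) :
    len (simpleRefl i * v) < len v ↔ v⁻¹ (hi i) < v⁻¹ (lo i) := by
  refine ⟨fun h => ?_, len_gt_of_inv_gt i v⟩
  rcases lt_trichotomy (v⁻¹ (hi i)) (v⁻¹ (lo i)) with h' | h' | h'
  · exact h'
  · exact absurd (v⁻¹.injective h') (lo_ne_hi i).symm
  · exact absurd (len_lt_of_inv_lt i v h') h.not_gt

theorem len_lt_simpleRefl_mul_iff (i : Fin (n - 1)) (v : Equiv.Perm (Fin n)) :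
    len v < len (simpleRefl i * v) ↔ v⁻¹ (lo i) < v⁻¹ (hi i) := by
  have := len_simpleRefl_mul_lt_iff i (simpleRefl i * v)
  rwa [simpleRefl_mul_cancel, inv_simpleRefl_mul, inv_simpleRefl_mul, simpleRefl_lo,
    simpleRefl_hi] at this

theorem eq_one_of_forall_lt (w : Equiv.Perm (Fin n)) (h : ∀ i, w (lo i) < w (hi i)) : w = 1 := by
  have hm : StrictMono w := by
    rcases n with _ | n
    · exact fun a => a.elim0
    · exact Fin.strictMono_iff_lt_succ.2 h
  have : (hm.orderIsoOfSurjective w w.surjective) = OrderIso.refl _ := Subsingleton.elim _ _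
  ext k
  have := congrArg (fun e : Fin n ≃o Fin n => ((e k : Fin n) : ℕ)) this
  simpa using this

theorem eq_rev_of_forall_lt (w : Equiv.Perm (Fin n)) (h : ∀ i, w (hi i) < w (lo i)) :
    w = Fin.revPerm := by
  have := eq_one_of_forall_lt (Fin.revPerm * w) fun i => by simpa using h i
  ext k
  have := congrArg (fun e : Equiv.Perm (Fin n) => Fin.rev (e k)) this
  simp at this
  rw [this]; rfl

theorem eq_one_of_forall_len (v : Equiv.Perm (Fin n))
    (h : ∀ i, ¬ len (simpleRefl i * v) < len v) : v = 1 := by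
  rw [← inv_eq_one]
  refine eq_one_of_forall_lt _ fun i => ?_
  have := (len_simpleRefl_mul_lt_iff i v).not.1 (h i)
  exact lt_of_le_of_ne (not_lt.1 this) fun h' => lo_ne_hi i (v⁻¹.injective h')

theorem len_one : len (1 : Equiv.Perm (Fin n)) = 0 := by
  rw [len, Finset.card_eq_zero, Finset.filter_eq_empty_iff]
  rintro p - ⟨h1, h2⟩
  exact h1.not_gt h2

theorem len_le_len_rev (v : Equiv.Perm (Fin n)) : len v ≤ len (Fin.revPerm : Equiv.Perm (Fin n)) := by
  refine Finset.card_le_card fun p hp => ?_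
  simp only [Finset.mem_filter, Finset.mem_univ, true_and] at hp ⊢
  exact ⟨hp.1, by simpa using hp.1⟩

theorem BruhatLE.eq_or_len_lt {u v : Equiv.Perm (Fin n)} (h : BruhatLE u v) :
    u = v ∨ len u < len v := by
  induction h with
  | refl => exact Or.inl rfl
  | tail _ h ih =>
    obtain ⟨_, _, _, _, h⟩ := h
    rcases ih with rfl | ih
    · exact Or.inr h
    · exact Or.inr (ih.trans h)

theorem bruhatLE_simpleRefl_mul (i : Fin (n - 1)) (v : Equiv.Perm (Fin n))
    (h : len v < len (simpleRefl i * v)) : BruhatLE v (simpleRefl i * v) :=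
  Relation.ReflTransGen.single ⟨_, _, fun h' => lo_ne_hi i (v⁻¹.injective h'),
    simpleRefl_mul_eq i v, h⟩

/-- A simple reflection preserves the order of `a i < a j` unless these are the two values it
exchanges; in that case left and right multiplication give the same permutation. -/
theorem bruhat_step_cases (s : Fin (n - 1)) (a : Equiv.Perm (Fin n)) {i j : Fin n} (hij : i < j)
    (h : len a < len (a * Equiv.swap i j)) :
    len (simpleRefl s * a) < len (simpleRefl s * a * Equiv.swap i j)
      ∨ simpleRefl s * a = a * Equiv.swap i j := by
  have haij : a i < a j := by
    rcases lt_trichotomy (a i) (a j) with h' | h' | h'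
    · exact h'
    · exact absurd (a.injective h') hij.ne
    · have := len_lt_len_mul_swap (a * Equiv.swap i j) hij (by simpa using h')
      rw [mul_assoc, Equiv.swap_mul_self, mul_one] at this
      exact absurd this h.not_gt
  by_cases h1 : a i = lo s ∧ a j = hi s
  · right
    rw [Equiv.mul_swap_eq_swap_mul, h1.1, h1.2]; rfl
  · left
    refine len_lt_len_mul_swap _ hij ?_
    rw [Equiv.Perm.mul_apply, Equiv.Perm.mul_apply, simpleRefl_lt_iff s h1]
    · exact haij
    · rintro ⟨h2, h3⟩
      rw [h2, h3] at haij
      exact absurd haij (lo_lt_hi s).not_gt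

/-- A weak lifting property, free of descent hypotheses: the chain from `a` to `b` is multiplied by
`s` step by step until either it ends or some step is itself multiplication by `s`, after which the
original chain takes over. -/
theorem BruhatLE.lift (s : Fin (n - 1)) {a b : Equiv.Perm (Fin n)} (h : BruhatLE a b) :
    BruhatLE (simpleRefl s * a) b ∨ BruhatLE (simpleRefl s * a) (simpleRefl s * b) := by
  induction h using Relation.ReflTransGen.head_induction_on with
  | refl => exact Or.inr Relation.ReflTransGen.refl
  | head hac hcb ih =>
    rename_i a c
    obtain ⟨i, j, hij, rfl, hlen⟩ := hac
    have key : len (simpleRefl s * a) < len (simpleRefl s * a * Equiv.swap i j)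
        ∨ simpleRefl s * a = a * Equiv.swap i j := by
      rcases lt_or_gt_of_ne hij with h' | h'
      · exact bruhat_step_cases s a h' hlen
      · rw [Equiv.swap_comm] at hlen ⊢
        exact bruhat_step_cases s a h' hlen
    rcases key with key | key
    · have hstep : BruhatLE (simpleRefl s * a) (simpleRefl s * (a * Equiv.swap i j)) :=
        Relation.ReflTransGen.single ⟨i, j, hij, by rw [mul_assoc], by rwa [← mul_assoc]⟩
      rcases ih with ih | ih
      · exact Or.inl (hstep.trans ih)
      · exact Or.inr (hstep.trans ih)
    · left
      rw [key]
      exact hcb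

end Length

/-! ### Commutation and braid relations of the recursion operators -/

section Recursion

variable {n : ℕ} {K : Type*} [Field K]

/-- The operator that expresses `r_{·, v}` through `r_{·, s v}` for a left descent `s = s_i` of `v`,
where `b` is the value `y^β`. -/
def recOp (q : K) (i : Fin (n - 1)) (b : K) (f : Equiv.Perm (Fin n) → K)
    (u : Equiv.Perm (Fin n)) : K :=
  if u⁻¹ (hi i) < u⁻¹ (lo i) then (1 - q) / (1 - b) * f u + f (simpleRefl i * u)
  else (1 - q) * (b / (1 - b)) * f u + q * f (simpleRefl i * u)

theorem recOp_comm (q : K) {i j : Fin (n - 1)} (hij : (i : ℕ) + 1 < j) (a b : K)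
    (f : Equiv.Perm (Fin n) → K) : recOp q i a (recOp q j b f) = recOp q j b (recOp q i a f) := by
  obtain ⟨h1, h2, h3, h4⟩ := simpleRefl_far hij
  ext u
  simp only [recOp, inv_simpleRefl_mul, h1, h2, h3, h4, simpleRefl_comm hij]
  split_ifs <;> ring

/-- The parameters are the character values of the inverted roots along the two reduced words of the
longest element of `S_3`: the same three values in opposite orders, the middle root being the sum of
the outer ones. The check runs over the relative orders of three positions. -/
theorem recOp_braid (q : K) {i j : Fin (n - 1)} (hij : (i : ℕ) + 1 = j) {a b : K} (ha : a ≠ 1)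
    (hb : b ≠ 1) (hab : a * b ≠ 1) (f : Equiv.Perm (Fin n) → K) :
    recOp q i a (recOp q j (a * b) (recOp q i b f))
      = recOp q j b (recOp q i (a * b) (recOp q j a f)) := by
  obtain ⟨hlo, h02, e1, e2, e3, e4⟩ := simpleRefl_adjacent hij
  ext u
  have n1 : u⁻¹ (lo i) ≠ u⁻¹ (hi i) := u⁻¹.injective.ne (lo_ne_hi i)
  have n2 : u⁻¹ (hi i) ≠ u⁻¹ (hi j) := u⁻¹.injective.ne (hlo ▸ lo_ne_hi j)
  have n3 : u⁻¹ (lo i) ≠ u⁻¹ (hi j) := u⁻¹.injective.ne h02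
  have ha' : 1 - a ≠ 0 := sub_ne_zero.2 ha.symm
  have hb' : 1 - b ≠ 0 := sub_ne_zero.2 hb.symm
  have hab' : 1 - a * b ≠ 0 := sub_ne_zero.2 hab.symm
  simp only [recOp, inv_simpleRefl_mul, hlo, e1, e2, e3, e4, simpleRefl_lo, simpleRefl_hi,
    simpleRefl_braid hij,
    simpleRefl_mul_cancel]
  rcases lt_or_gt_of_ne n1 with h1 | h1 <;> rcases lt_or_gt_of_ne n2 with h2 | h2 <;>
    rcases lt_or_gt_of_ne n3 with h3 | h3 <;>
    first
    | (exfalso; order)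
    | (simp only [h1, h2, h3, h1.not_gt, h2.not_gt, h3.not_gt, if_true, if_false]
       field_simp
       ring)

end Recursion


/-! ### Existence and uniqueness of the family `r` -/

section BumpNakasuji

variable {n : ℕ} {K : Type*} [Field K]

theorem IsBumpNakasuji.eq_recOp {q : K} {y : Fin n → K}
    {r : Equiv.Perm (Fin n) → Equiv.Perm (Fin n) → K} (h : IsBumpNakasuji q y r)
    (v : Equiv.Perm (Fin n)) (i : Fin (n - 1)) (hv : len (simpleRefl i * v) < len v) :
    (fun u => r u v) = recOp q i (betaVal y v i) fun u => r u (simpleRefl i * v) := by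
  ext u
  unfold recOp
  split_ifs with hu
  · exact h.rec_descent u v i hv (len_gt_of_inv_gt i u hu)
  · refine h.rec_ascent u v i hv (len_lt_of_inv_lt i u ?_)
    exact lt_of_le_of_ne (not_lt.1 hu) fun h' => lo_ne_hi i (u⁻¹.injective h')

theorem IsBumpNakasuji.unique {q : K} {y : Fin n → K}
    {r r' : Equiv.Perm (Fin n) → Equiv.Perm (Fin n) → K} (h : IsBumpNakasuji q y r)
    (h' : IsBumpNakasuji q y r') : r = r' := by
  have key : ∀ k v, len v = k → (fun u => r u v) = fun u => r' u v := by
    intro k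
    induction k using Nat.strong_induction_on with
    | _ k ih =>
      rintro v rfl
      by_cases hv : ∃ i, len (simpleRefl i * v) < len v
      · obtain ⟨i, hi⟩ := hv
        rw [h.eq_recOp v i hi, h'.eq_recOp v i hi, ih _ hi _ rfl]
      · obtain rfl := eq_one_of_forall_len v (not_exists.1 hv)
        ext u
        by_cases hu : u = 1
        · rw [hu, h.diag, h'.diag]
        · have hnot : ¬ BruhatLE u 1 := fun hle => by
            rcases hle.eq_or_len_lt with h1 | h1
            · exact hu h1
            · simp [len_one] at h1
          rw [h.vanish _ _ hnot, h'.vanish _ _ hnot]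
  ext u v
  exact congrFun (key _ v rfl) u

theorem exists_descent_rPoly_eq (q : K) (y : Fin n → K) (v : Equiv.Perm (Fin n))
    (h : ∃ i, len (simpleRefl i * v) < len v) : ∃ i, len (simpleRefl i * v) < len v ∧
      (fun u => rPoly q y u v)
        = recOp q i (betaVal y v i) fun u => rPoly q y u (simpleRefl i * v) := by
  refine ⟨h.choose, h.choose_spec, ?_⟩
  ext u
  rw [rPoly.eq_1, dif_pos h]
  unfold recOp
  exact if_congr (len_simpleRefl_mul_lt_iff _ _) rfl rfl

theorem rPoly_one (q : K) (y : Fin n → K) (u : Equiv.Perm (Fin n)) :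
    rPoly q y u 1 = if u = 1 then 1 else 0 := by
  rw [rPoly.eq_1, dif_neg]
  rintro ⟨i, hi⟩
  simp [len_one] at hi

theorem betaVal_ne_one {y : Fin n → K} (hy0 : ∀ i, y i ≠ 0) (hy : Function.Injective y)
    (v : Equiv.Perm (Fin n)) (i : Fin (n - 1)) : betaVal y v i ≠ 1 := by
  rw [betaVal, rootVal, Ne, div_eq_one_iff_eq (hy0 _)]
  exact fun h => lo_ne_hi i (v⁻¹.injective (hy h)).symm

/-- `rPoly` recurses along one chosen descent; this removes the choice. By induction on length, the
expansions along two descents can be continued down to a common shorter permutation, where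
`recOp_comm` or `recOp_braid` compares them. -/
theorem rPoly_eq_recOp (q : K) {y : Fin n → K} (hy0 : ∀ i, y i ≠ 0) (hy : Function.Injective y)
    (v : Equiv.Perm (Fin n)) (i : Fin (n - 1)) (hv : len (simpleRefl i * v) < len v) :
    (fun u => rPoly q y u v)
      = recOp q i (betaVal y v i) fun u => rPoly q y u (simpleRefl i * v) := by
  induction hk : len v using Nat.strong_induction_on generalizing v i with
  | _ k ih =>
    have consistent : ∀ i j : Fin (n - 1), i < j → len (simpleRefl i * v) < len v →
        len (simpleRefl j * v) < len v →
        (recOp q i (betaVal y v i) fun u => rPoly q y u (simpleRefl i * v))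
          = recOp q j (betaVal y v j) fun u => rPoly q y u (simpleRefl j * v) := by
      intro i j hij hi hj
      have hvi := (len_simpleRefl_mul_lt_iff _ _).1 hi
      have hvj := (len_simpleRefl_mul_lt_iff _ _).1 hj
      rcases Nat.lt_or_ge ((i : ℕ) + 1) j with hfar | hnear
      · obtain ⟨h1, h2, h3, h4⟩ := simpleRefl_far hfar
        rw [ih _ (hk ▸ hi) (simpleRefl i * v) j
            (len_gt_of_inv_gt _ _ (by simpa only [inv_simpleRefl_mul, h3, h4] using hvj)) rfl,
          ih _ (hk ▸ hj) (simpleRefl j * v) i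
            (len_gt_of_inv_gt _ _ (by simpa only [inv_simpleRefl_mul, h1, h2] using hvi)) rfl,
          simpleRefl_comm hfar]
        simp only [betaVal, inv_simpleRefl_mul, h1, h2, h3, h4]
        exact recOp_comm q hfar _ _ _
      · have hij' : (i : ℕ) + 1 = j := by
          have : (i : ℕ) < j := hij
          omega
        obtain ⟨hlo, h02, e1, e2, e3, e4⟩ := simpleRefl_adjacent hij'
        rw [hlo] at hvj
        have d1 : len (simpleRefl j * (simpleRefl i * v)) < len (simpleRefl i * v) :=
          len_gt_of_inv_gt _ _ (by
            simpa only [inv_simpleRefl_mul, hlo, e1, simpleRefl_hi] using hvj.trans hvi)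
        have d2 : len (simpleRefl i * (simpleRefl j * v)) < len (simpleRefl j * v) :=
          len_gt_of_inv_gt _ _ (by
            simpa only [inv_simpleRefl_mul, e2, e3] using hvj.trans hvi)
        have d3 : len (simpleRefl i * (simpleRefl j * (simpleRefl i * v)))
            < len (simpleRefl j * (simpleRefl i * v)) :=
          len_gt_of_inv_gt _ _ (by
            simpa only [inv_simpleRefl_mul, e1, e2, e3, simpleRefl_lo] using hvj)
        have d4 : len (simpleRefl j * (simpleRefl i * (simpleRefl j * v)))
            < len (simpleRefl i * (simpleRefl j * v)) :=
          len_gt_of_inv_gt _ _ (by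
            simpa only [inv_simpleRefl_mul, hlo, e1, e2, e4, simpleRefl_hi] using hvi)
        rw [ih _ (hk ▸ hi) (simpleRefl i * v) j d1 rfl,
          ih _ (hk ▸ hj) (simpleRefl j * v) i d2 rfl,
          ih _ (hk ▸ d1.trans hi) _ i d3 rfl, ih _ (hk ▸ d2.trans hj) _ j d4 rfl,
          simpleRefl_braid hij']
        simp only [betaVal, inv_simpleRefl_mul, hlo, e1, e2, e3, e4, simpleRefl_lo, simpleRefl_hi]
        -- Additivity of roots, `e_c - e_a = (e_b - e_a) + (e_c - e_b)`, gives the middle parameter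
        -- the form `a * b` of the braid relation.
        have hmul : rootVal y (v⁻¹ (ColoredLattice.hi j)) (v⁻¹ (lo i))
            = rootVal y (v⁻¹ (ColoredLattice.hi i)) (v⁻¹ (lo i))
              * rootVal y (v⁻¹ (ColoredLattice.hi j)) (v⁻¹ (ColoredLattice.hi i)) := by
          have := hy0 (v⁻¹ (ColoredLattice.hi i))
          have := hy0 (v⁻¹ (lo i))
          unfold rootVal
          field_simp
        rw [hmul]
        refine recOp_braid q hij' (betaVal_ne_one hy0 hy v i) ?_ ?_ _
        · have := betaVal_ne_one hy0 hy v j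
          rwa [betaVal, hlo] at this
        · rw [betaVal, ← hmul, rootVal, Ne, div_eq_one_iff_eq (hy0 _)]
          exact fun h => h02 (v⁻¹.injective (hy h)).symm
    obtain ⟨j, hj, hjv⟩ := exists_descent_rPoly_eq q y v ⟨i, hv⟩
    rw [hjv]
    rcases lt_trichotomy i j with hij | rfl | hij
    · exact (consistent i j hij hv hj).symm
    · rfl
    · exact consistent j i hij hj hv

/-- One of the two terms of the recursion is nonzero, so `u ≤ s v` or `s u ≤ s v`; lifting turns the
second alternative into `u ≤ s v` or `u ≤ v`. -/
theorem rPoly_vanish (q : K) (y : Fin n → K) (u v : Equiv.Perm (Fin n)) (h : rPoly q y u v ≠ 0) :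
    BruhatLE u v := by
  induction hk : len v using Nat.strong_induction_on generalizing u v with
  | _ k ih =>
    by_cases hv : ∃ i, len (simpleRefl i * v) < len v
    · obtain ⟨i, hi, hrec⟩ := exists_descent_rPoly_eq q y v hv
      have hle : BruhatLE (simpleRefl i * v) v := by
        have := bruhatLE_simpleRefl_mul i (simpleRefl i * v)
        rw [simpleRefl_mul_cancel] at this
        exact this hi
      have hcases : BruhatLE u (simpleRefl i * v) ∨ BruhatLE (simpleRefl i * u) (simpleRefl i * v) := by
        by_contra hcon
        rw [not_or] at hcon
        have h1 : rPoly q y u (simpleRefl i * v) = 0 := by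
          by_contra h'
          exact hcon.1 (ih _ (hk ▸ hi) _ _ h' rfl)
        have h2 : rPoly q y (simpleRefl i * u) (simpleRefl i * v) = 0 := by
          by_contra h'
          exact hcon.2 (ih _ (hk ▸ hi) _ _ h' rfl)
        have := congrFun hrec u
        simp only [recOp, h1, h2, mul_zero, add_zero, ite_self] at this
        exact h this
      rcases hcases with hu | hu
      · exact hu.trans hle
      · have := hu.lift i
        rw [simpleRefl_mul_cancel, simpleRefl_mul_cancel] at this
        rcases this with h1 | h1
        · exact h1.trans hle
        · exact h1
    · obtain rfl := eq_one_of_forall_len v (not_exists.1 hv)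
      rw [rPoly_one] at h
      obtain rfl : u = 1 := by
        by_contra h'
        simp [h'] at h
      exact Relation.ReflTransGen.refl

theorem rPoly_diag (q : K) (y : Fin n → K) (v : Equiv.Perm (Fin n)) : rPoly q y v v = 1 := by
  induction hk : len v using Nat.strong_induction_on generalizing v with
  | _ k ih =>
    by_cases hv : ∃ i, len (simpleRefl i * v) < len v
    · obtain ⟨i, hi, hrec⟩ := exists_descent_rPoly_eq q y v hv
      have h1 : rPoly q y v (simpleRefl i * v) = 0 := by
        by_contra h'
        rcases (rPoly_vanish q y _ _ h').eq_or_len_lt with h'' | h''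
        · exact absurd (congrArg len h'') hi.ne'
        · exact absurd h'' hi.not_gt
      have := congrFun hrec v
      simp only [recOp, if_pos ((len_simpleRefl_mul_lt_iff _ _).1 hi), h1, mul_zero, zero_add,
        ih _ (hk ▸ hi) _ rfl] at this
      exact this
    · obtain rfl := eq_one_of_forall_len v (not_exists.1 hv)
      simp [rPoly_one]

theorem isBumpNakasuji_rPoly (q : K) {y : Fin n → K} (hy0 : ∀ i, y i ≠ 0)
    (hy : Function.Injective y) : IsBumpNakasuji q y (rPoly q y) where
  vanish u v h := by
    by_contra h'
    exact h (rPoly_vanish q y u v h')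
  diag := rPoly_diag q y
  rec_descent u v i hv hu := by
    have := congrFun (rPoly_eq_recOp q hy0 hy v i hv) u
    rwa [recOp, if_pos ((len_simpleRefl_mul_lt_iff _ _).1 hu)] at this
  rec_ascent u v i hv hu := by
    have := congrFun (rPoly_eq_recOp q hy0 hy v i hv) u
    rwa [recOp, if_neg ((len_lt_simpleRefl_mul_iff _ _).1 hu).not_gt] at this

end BumpNakasuji


/-! ### Path sums as products of transfer matrices -/

section Paths

variable {ι R : Type*} [Fintype ι] [DecidableEq ι] [CommSemiring R]

/-- The sum over the paths of length `k` from `a` to `b` of the products of the weights `M j` of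
their steps. -/
def pathSum (M : ℕ → ι → ι → R) : ℕ → ι → ι → R
  | 0, a, b => if a = b then 1 else 0
  | k + 1, a, b => ∑ c, pathSum M k a c * M k c b

theorem pathSum_congr {M M' : ℕ → ι → ι → R} {k : ℕ} (h : ∀ j < k, M j = M' j) :
    pathSum M k = pathSum M' k := by
  induction k with
  | zero => rfl
  | succ k ih =>
    ext a b
    simp only [pathSum, ih fun j hj => h j (hj.trans k.lt_succ_self), h k k.lt_succ_self]

/-- Used in both directions of the grid: for the horizontal labels of one row, and for the sequence
of all vertical labels from row to row. -/
theorem sum_paths (M : ℕ → ι → ι → R) (m : ℕ) (a b : ι) :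
    (∑ h : Fin (m + 1) → ι, if h 0 = a ∧ h (Fin.last m) = b then
      ∏ j : Fin m, M j (h j.castSucc) (h j.succ) else 0) = pathSum M m a b := by
  induction m generalizing b with
  | zero =>
    rw [← (Equiv.funUnique (Fin 1) ι).symm.sum_comp]
    simp only [pathSum]
    by_cases hab : a = b
    · subst hab; simp
    · rw [if_neg hab]
      refine Finset.sum_eq_zero fun x _ => if_neg ?_
      rintro ⟨h1, h2⟩
      exact hab (h1.symm.trans h2)
  | succ m ih =>
    rw [← (Fin.snocEquiv fun _ : Fin (m + 2) => ι).sum_comp, Fintype.sum_prod_type]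
    simp only [pathSum, ← ih, Finset.sum_mul]
    have h0 : ∀ (x : ι) (h : Fin (m + 1) → ι),
        (Fin.snocEquiv fun _ : Fin (m + 2) => ι) (x, h) 0 = h 0 := fun x h =>
      Fin.snoc_castSucc (α := fun _ : Fin (m + 2) => ι) x h 0
    have h1 : ∀ (x : ι) (h : Fin (m + 1) → ι),
        (Fin.snocEquiv fun _ : Fin (m + 2) => ι) (x, h) (Fin.last _) = x := fun x h =>
      Fin.snoc_last (α := fun _ : Fin (m + 2) => ι) x h
    have h2 : ∀ (x : ι) (h : Fin (m + 1) → ι) (i : Fin (m + 1)),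
        (Fin.snocEquiv fun _ : Fin (m + 2) => ι) (x, h) i.castSucc = h i := fun x h i =>
      Fin.snoc_castSucc (α := fun _ : Fin (m + 2) => ι) x h i
    simp only [Fin.prod_univ_castSucc, h0, h1, ← Fin.castSucc_succ, h2, Fin.succ_last]
    rw [Finset.sum_eq_single b]
    · rw [Finset.sum_comm]
      refine Finset.sum_congr rfl fun h _ => ?_
      rw [Finset.sum_eq_single (h (Fin.last m))]
      · simp
      · intro c _ hc
        rw [if_neg (fun h' => hc h'.2.symm), zero_mul]
      · simp
    · intro c _ hc
      exact Finset.sum_eq_zero fun h _ => if_neg fun h' => hc h'.2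
    · simp

/-- A linear relation between products of two consecutive steps carries over to path sums. -/
theorem pathSum_relation {M₀ M₁ M₂ : ℕ → ι → ι → R} {k m : ℕ} (hk : k + 2 ≤ m) {a : ι}
    {c₀ c₁ c₂ : R} (h1 : ∀ j, j ≠ k → j ≠ k + 1 → M₁ j = M₀ j)
    (h2 : ∀ j, j ≠ k → j ≠ k + 1 → M₂ j = M₀ j)
    (h : ∀ d, pathSum M₀ k a d ≠ 0 → ∀ b,
      c₀ * ∑ e, M₀ k d e * M₀ (k + 1) e b
        = c₁ * (∑ e, M₁ k d e * M₁ (k + 1) e b) + c₂ * ∑ e, M₂ k d e * M₂ (k + 1) e b) (b : ι) :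
    c₀ * pathSum M₀ m a b = c₁ * pathSum M₁ m a b + c₂ * pathSum M₂ m a b := by
  induction m, hk using Nat.le_induction generalizing b with
  | base =>
    have e1 : pathSum M₁ k = pathSum M₀ k := pathSum_congr fun j hj => h1 j (by omega) (by omega)
    have e2 : pathSum M₂ k = pathSum M₀ k := pathSum_congr fun j hj => h2 j (by omega) (by omega)
    have key : ∀ M : ℕ → ι → ι → R, pathSum M (k + 2) a b
        = ∑ d, pathSum M k a d * ∑ e, M k d e * M (k + 1) e b := by
      intro M
      simp only [pathSum, Finset.sum_mul, Finset.mul_sum]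
      rw [Finset.sum_comm]
      simp only [mul_assoc]
    rw [key, key, key, e1, e2, Finset.mul_sum, Finset.mul_sum, Finset.mul_sum,
      ← Finset.sum_add_distrib]
    refine Finset.sum_congr rfl fun d _ => ?_
    -- The local relation is only assumed at intermediate points that the start can reach; the
    -- others contribute zero.
    by_cases hd : pathSum M₀ k a d = 0
    · simp [hd]
    · rw [mul_left_comm, h d hd b]
      ring
  | succ m hm ih =>
    simp only [pathSum, Finset.mul_sum]
    rw [← Finset.sum_add_distrib]
    refine Finset.sum_congr rfl fun e _ => ?_
    rw [h1 m (by omega) (by omega), h2 m (by omega) (by omega), ← mul_assoc, ih e]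
    ring

end Paths


/-! ### Factorization of the Boltzmann weights -/

section YangBaxter

variable {n : ℕ} {K : Type*} [Field K]

/-- The factor that a color `e` on the vertical edge contributes for the left label `l`. -/
def leftFactor (q : K) : Option (Fin n) → Fin n → K
  | none, _ => -q
  | some c, e => if c < e then -q else 1

/-- The factor that a color `e` on the vertical edge contributes for the right label `r`. -/
def rightFactor : Option (Fin n) → Fin n → K
  | none, _ => 1
  | some c, e => if c < e then -1 else 1

/-- The weight of a vertex without spectator colors. -/
def bareWeight (q z : K) : Option (Fin n) → Option (Fin n) → K
  | none, none => 1
  | none, some _ => 1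
  | some _, none => (q - 1) * z
  | some a, some b => if a = b then 1 - z else if a < b then (q - 1) * z else q - 1

theorem prod_ite_pow {ι : Type*} (S : Finset ι) (p : ι → Prop) [DecidablePred p] (a b : K) :
    ∏ e ∈ S, (if p e then a else b) = a ^ (S.filter p).card * b ^ (S.filter (¬ p ·)).card := by
  rw [Finset.prod_ite]; simp

/-- All six cases in one formula: every spectator color contributes its own factor, independently of
the others. Disjointness removes the case where the color on the left also occurs above. -/
theorem kWeight_eq (q x y : K) (l r : Option (Fin n)) (S B : Finset (Fin n))
    (hl : Disjoint l.toFinset S) :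
    kWeight q x y l S r B =
      if r.toFinset ⊆ l.toFinset ∪ S ∧ B = (l.toFinset ∪ S) \ r.toFinset then
        bareWeight q (x * y⁻¹) l r * ∏ e ∈ S \ r.toFinset, leftFactor q l e * rightFactor r e
      else 0 := by
  rcases l with _ | a <;> rcases r with _ | b
  · simp [kWeight, bareWeight, leftFactor, rightFactor]
  · have h : ∀ e ∈ S \ {b}, leftFactor q (none : Option (Fin n)) e * rightFactor (some b) e
        = if e < b then -q else q := by
      intro e he
      have : e ≠ b := by simp at he; exact he.2
      simp only [leftFactor, rightFactor]
      rcases lt_or_gt_of_ne this with h | h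
      · simp [h, h.le]
      · simp [h, h.le]
    simp only [kWeight, bareWeight, Option.toFinset_some, Option.toFinset_none, Finset.empty_union,
      Finset.singleton_subset_iff, Finset.erase_eq]
    refine if_congr Iff.rfl ?_ rfl
    rw [Finset.prod_congr rfl h, prod_ite_pow, one_mul]
    congr 3
    · ext e; simp only [Finset.mem_filter, Finset.mem_sdiff, Finset.mem_singleton]; grind
    · ext e; simp only [Finset.mem_filter, Finset.mem_sdiff, Finset.mem_singleton]; grind
  · have ha : a ∉ S := by simpa using hl
    simp only [kWeight, bareWeight, Option.toFinset_some, Option.toFinset_none,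
      Finset.empty_subset, true_and, Finset.sdiff_empty, leftFactor, rightFactor, mul_one, ha,
      not_false_eq_true, Finset.insert_eq, prod_ite_pow, one_pow]
  · have ha : a ∉ S := by simpa using hl
    simp only [kWeight, bareWeight, Option.toFinset_some]
    by_cases hab : a = b
    · subst hab
      have h1 : ({a} ∪ S) \ {a} = S := by
        ext e; simp; constructor
        · tauto
        · intro h; exact ⟨Or.inr h, fun h' => ha (h' ▸ h)⟩
      have h2 : S \ {a} = S := by simp [ha]
      have h3 : S.filter (· = a) = ∅ := by
        ext e; simp; rintro h rfl; exact ha h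
      simp only [h1, h2, h3, if_true, leftFactor, rightFactor]
      simp only [Finset.singleton_subset_iff, Finset.mem_union, Finset.mem_singleton, true_or,
        true_and]
      refine if_congr Iff.rfl ?_ rfl
      have : ∀ e ∈ S, ((if a < e then -q else 1) * (if a < e then -1 else 1) : K)
          = if a < e then q else 1 := by intro e _; split_ifs <;> ring
      rw [Finset.prod_congr rfl this, prod_ite_pow]
      simp; ring
    · simp only [if_neg hab, ha, not_false_eq_true, true_and, Finset.singleton_subset_iff,
        Finset.mem_union, Finset.mem_singleton, Ne.symm hab, false_or, Finset.erase_eq,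
        Finset.insert_eq]
      refine if_congr Iff.rfl ?_ rfl
      have hS : ∀ e ∈ S \ {b}, e ≠ a ∧ e ≠ b := by
        intro e he
        simp at he
        exact ⟨fun h => ha (h ▸ he.1), he.2⟩
      rcases lt_or_gt_of_ne hab with h | h
      · have : ∀ e ∈ S \ {b}, leftFactor q (some a) e * rightFactor (some b) e
          = (if a < e ∧ e < b then -q else 1) * (if b < e then q else 1) := by
          intro e he
          obtain ⟨h1, h2⟩ := hS e he
          simp only [leftFactor, rightFactor]
          rcases lt_or_gt_of_ne h1 with h3 | h3
          · simp [h3.not_gt, (h3.trans h).not_gt]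
          · rcases lt_or_gt_of_ne h2 with h4 | h4
            · simp [h3, h4, h4.not_gt]
            · simp [h3, h4, h4.not_gt]
        rw [Finset.prod_congr rfl this, Finset.prod_mul_distrib, prod_ite_pow, prod_ite_pow]
        have e1 : (S \ {b}).filter (fun e => a < e ∧ e < b) = S.filter (fun e => a < e ∧ e < b) := by
          ext e; simp only [Finset.mem_filter, Finset.mem_sdiff, Finset.mem_singleton]; grind
        have e2 : (S \ {b}).filter (fun e => b < e) = S.filter (fun e => b < e) := by
          ext e; simp only [Finset.mem_filter, Finset.mem_sdiff, Finset.mem_singleton]; grind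
        simp only [if_pos h, one_pow, mul_one, mul_assoc, e1, e2]
      · have : ∀ e ∈ S \ {b}, leftFactor q (some a) e * rightFactor (some b) e
          = (if b < e ∧ e < a then -1 else 1) * (if a < e then q else 1) := by
          intro e he
          obtain ⟨h1, h2⟩ := hS e he
          simp only [leftFactor, rightFactor]
          rcases lt_or_gt_of_ne h1 with h3 | h3
          · rcases lt_or_gt_of_ne h2 with h4 | h4
            · simp [h3.not_gt, h4.not_gt]
            · simp [h3, h4, h3.not_gt]
          · simp [h3, h3.not_gt, h.trans h3]
        rw [Finset.prod_congr rfl this, Finset.prod_mul_distrib, prod_ite_pow, prod_ite_pow]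
        have e1 : (S \ {b}).filter (fun e => b < e ∧ e < a) = S.filter (fun e => b < e ∧ e < a) := by
          ext e; simp only [Finset.mem_filter, Finset.mem_sdiff, Finset.mem_singleton]; grind
        have e2 : (S \ {b}).filter (fun e => a < e) = S.filter (fun e => a < e) := by
          ext e; simp only [Finset.mem_filter, Finset.mem_sdiff, Finset.mem_singleton]; grind
        simp only [if_neg h.not_gt, one_pow, mul_one, mul_assoc, e1, e2]

/-- Color conservation at a vertex. -/
theorem kWeight_conserve (q x y : K) (l r : Option (Fin n)) (S B : Finset (Fin n))
    (h : kWeight q x y l S r B ≠ 0) (c : Fin n) :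
    (if c ∈ B then 1 else 0) + (if c ∈ r then 1 else 0)
      = (if c ∈ S then 1 else 0) + (if c ∈ l then 1 else (0 : ℕ)) := by
  rcases l with _ | a <;> rcases r with _ | b <;> simp only [kWeight] at h
  · split_ifs at h with h1
    · simp [h1]
    · simp at h
  · split_ifs at h with h1
    · obtain ⟨h1, rfl⟩ := h1
      by_cases hc : b = c
      · subst hc; simp [h1]
      · simp [hc, Ne.symm hc]
    · simp at h
  · split_ifs at h with h1
    · obtain ⟨h1, rfl⟩ := h1
      by_cases hc : a = c
      · subst hc; simp [h1]
      · simp [hc, Ne.symm hc]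
    · simp at h
  · split_ifs at h with h1 h2 h2 h3
    · subst h1 h2; rfl
    · simp at h
    all_goals first
      | (exfalso; exact h rfl)
      | (obtain ⟨h3, h4, rfl⟩ := h2
         by_cases hc : a = c
         · subst hc; simp [h3, Ne.symm h1, h1]
         · by_cases hc' : b = c
           · subst hc'; simp [h4, h1]
           · simp [hc, hc', Ne.symm hc, Ne.symm hc'])

/-- Diagonal entries of the R-matrix. -/
def rDiag (q x₁ x₂ : K) : Option (Fin n) × Option (Fin n) → K
  | (none, none) => x₂ - q * x₁
  | (none, some _) => (1 - q) * x₁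
  | (some _, none) => (1 - q) * x₂
  | (some a, some b) => if a < b then (1 - q) * x₂ else (1 - q) * x₁

/-- Off-diagonal entries of the R-matrix. -/
def rSwap (q x₁ x₂ : K) : Option (Fin n) × Option (Fin n) → K
  | (none, none) => 0
  | (none, some _) => x₁ - x₂
  | (some _, none) => q * (x₁ - x₂)
  | (some a, some b) => if a < b then x₁ - x₂ else q * (x₁ - x₂)

/-- The joint weight of two vertically adjacent vertices in rows with parameters `x₁`, `x₂`. -/
def pairWeight (q x₁ x₂ y : K) (S B : Finset (Fin n)) (l r : Option (Fin n) × Option (Fin n)) : K :=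
  ∑ M : Finset (Fin n), kWeight q x₁ y l.1 S r.1 M * kWeight q x₂ y l.2 M r.2 B

/-- The part of `pairWeight` that depends on the order of the labels. -/
def barePair (q z₁ z₂ : K) (S : Finset (Fin n)) (l r : Option (Fin n) × Option (Fin n)) : K :=
  if r.1.toFinset ⊆ l.1.toFinset ∪ S then
    bareWeight q z₁ l.1 r.1 * bareWeight q z₂ l.2 r.2
      * (∏ e ∈ r.2.toFinset ∩ S, leftFactor q l.1 e * rightFactor r.1 e)
      * ∏ e ∈ l.1.toFinset \ (r.1.toFinset ∪ r.2.toFinset), leftFactor q l.2 e * rightFactor r.2 e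
  else 0

/-- Colors that are spectators at both vertices give a factor symmetric in the two rows, so it drops
out of the Yang–Baxter equation. What remains, `barePair`, involves only the at most four horizontal
labels and their membership in `S`. -/
theorem pairWeight_eq (q x₁ x₂ y : K) (S B : Finset (Fin n)) (l r : Option (Fin n) × Option (Fin n))
    (h1 : Disjoint l.1.toFinset l.2.toFinset) (h2 : Disjoint l.1.toFinset S)
    (h3 : Disjoint l.2.toFinset S) :
    pairWeight q x₁ x₂ y S B l r =
      if Disjoint r.1.toFinset r.2.toFinset
          ∧ r.1.toFinset ∪ r.2.toFinset ⊆ l.1.toFinset ∪ l.2.toFinset ∪ S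
          ∧ B = (l.1.toFinset ∪ l.2.toFinset ∪ S) \ (r.1.toFinset ∪ r.2.toFinset) then
        (∏ e ∈ S \ (r.1.toFinset ∪ r.2.toFinset),
          (leftFactor q l.1 e * leftFactor q l.2 e) * (rightFactor r.1 e * rightFactor r.2 e))
          * barePair q (x₁ * y⁻¹) (x₂ * y⁻¹) S l r
      else 0 := by
  obtain ⟨l1, l2⟩ := l
  obtain ⟨r1, r2⟩ := r
  simp only [pairWeight, barePair] at *
  by_cases hr : r1.toFinset ⊆ l1.toFinset ∪ S
  swap
  · rw [Finset.sum_eq_zero]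
    · simp [hr]
    · intro M _
      rw [kWeight_eq _ _ _ _ _ _ _ h2, if_neg (fun h => hr h.1), zero_mul]
  -- Color conservation at the upper vertex determines the edge between the rows.
  rw [Finset.sum_eq_single ((l1.toFinset ∪ S) \ r1.toFinset)]
  rotate_left
  · intro M _ hM
    rw [kWeight_eq _ _ _ _ _ _ _ h2, if_neg (fun h => hM h.2), zero_mul]
  · simp
  have h4 : Disjoint l2.toFinset ((l1.toFinset ∪ S) \ r1.toFinset) :=
    Finset.disjoint_of_subset_right Finset.sdiff_subset
      (Finset.disjoint_union_right.2 ⟨h1.symm, h3⟩)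
  have h5 : Disjoint l2.toFinset r1.toFinset :=
    Finset.disjoint_of_subset_right hr (Finset.disjoint_union_right.2 ⟨h1.symm, h3⟩)
  rw [kWeight_eq _ _ _ _ _ _ _ h2, if_pos ⟨hr, rfl⟩, kWeight_eq _ _ _ _ _ _ _ h4, if_pos hr]
  rw [mul_ite, mul_zero]
  rw [Finset.disjoint_left] at h1 h2 h3 h4 h5
  simp only [Finset.subset_iff] at hr
  by_cases hd : Disjoint r1.toFinset r2.toFinset
  swap
  · rw [if_neg, if_neg (fun h => hd h.1)]
    rintro ⟨h, -⟩
    apply hd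
    rw [Finset.disjoint_left]
    intro e he1 he2
    have := h he2
    simp only [Finset.mem_union, Finset.mem_sdiff] at this
    have := @h5 e
    tauto
  rw [Finset.disjoint_left] at hd
  refine if_congr ?_ ?_ rfl
  · have e1 : l2.toFinset ∪ (l1.toFinset ∪ S) \ r1.toFinset
        = (l1.toFinset ∪ l2.toFinset ∪ S) \ r1.toFinset := by
      ext e
      have := @h5 e
      simp only [Finset.mem_union, Finset.mem_sdiff]
      tauto
    rw [e1, sdiff_sdiff, Finset.disjoint_left]
    simp only [Finset.subset_iff, Finset.mem_union, Finset.mem_sdiff, Finset.sup_eq_union]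
    constructor
    · rintro ⟨h6, h7⟩
      refine ⟨@hd, fun e he => ?_, h7⟩
      have := @hr e
      have := @h6 e
      simp only [Finset.mem_union] at *
      tauto
    · rintro ⟨-, h6, h7⟩
      refine ⟨fun e he => ?_, h7⟩
      have := @hd e
      have := @h6 e
      tauto
  -- Besides the common spectators, the upper vertex sees the color of `S` that leaves in the lower
  -- row, and the lower vertex sees the color that enters in the upper row and leaves below.
  · have e1 : S \ r1.toFinset = (S \ (r1.toFinset ∪ r2.toFinset)) ∪ (r2.toFinset ∩ S) := by
      ext e
      have := @hd e
      simp only [Finset.mem_union, Finset.mem_sdiff, Finset.mem_inter]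
      tauto
    have e2 : ((l1.toFinset ∪ S) \ r1.toFinset) \ r2.toFinset
        = (S \ (r1.toFinset ∪ r2.toFinset)) ∪ (l1.toFinset \ (r1.toFinset ∪ r2.toFinset)) := by
      ext e
      simp only [Finset.mem_union, Finset.mem_sdiff]
      tauto
    rw [e1, e2, Finset.prod_union, Finset.prod_union]
    · simp only [Finset.prod_mul_distrib]
      ring
    · rw [Finset.disjoint_left]
      intro e
      have := @h2 e
      simp only [Finset.mem_union, Finset.mem_sdiff]
      tauto
    · rw [Finset.disjoint_left]
      intro e
      simp only [Finset.mem_union, Finset.mem_sdiff, Finset.mem_inter]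
      tauto

end YangBaxter


/-! ### The Yang–Baxter equation for at most four colors -/

section YangBaxterBare

variable {n : ℕ} {K : Type*} [Field K]

theorem barePair_eq (q z₁ z₂ : K) (S : Finset (Fin n)) (l r : Option (Fin n) × Option (Fin n)) :
    barePair q z₁ z₂ S l r =
      if ∀ e ∈ r.1.toFinset, e ∈ l.1.toFinset ∨ e ∈ S then
        bareWeight q z₁ l.1 r.1 * bareWeight q z₂ l.2 r.2
          * (∏ e ∈ r.2.toFinset, if e ∈ S then leftFactor q l.1 e * rightFactor r.1 e else 1)
          * ∏ e ∈ l.1.toFinset, if e ∈ r.1.toFinset ∨ e ∈ r.2.toFinset then 1 else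
              leftFactor q l.2 e * rightFactor r.2 e
      else 0 := by
  unfold barePair
  refine if_congr ?_ ?_ rfl
  · simp [Finset.subset_iff]
  · rw [Finset.prod_ite_mem]
    congr 1
    rw [← Finset.filter_notMem_eq_sdiff, Finset.prod_filter]
    refine Finset.prod_congr rfl fun e _ => ?_
    simp only [Finset.mem_union]
    split_ifs <;> tauto

theorem lt_cases_of_ne {a b : Fin n} (h : a ≠ b) :
    (a < b ∧ ¬ b < a ∧ a ≠ b ∧ b ≠ a) ∨ (b < a ∧ ¬ a < b ∧ a ≠ b ∧ b ≠ a) := by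
  rcases lt_or_gt_of_ne h with h | h
  · exact Or.inl ⟨h, h.not_gt, h.ne, h.ne'⟩
  · exact Or.inr ⟨h, h.not_gt, h.ne', h.ne⟩

set_option linter.unusedSimpArgs false in
set_option linter.unnecessarySeqFocus false in
set_option maxHeartbeats 4000000 in
-- A finite check. Each outgoing color is one of the incoming ones or comes from `S`; once this is
-- fixed together with the relative order of the colors, both sides are explicit polynomials.
theorem barePair_yangBaxter (q x₁ x₂ w : K) (S : Finset (Fin n))
    (l r : Option (Fin n) × Option (Fin n))
    (h1 : Disjoint l.1.toFinset l.2.toFinset) (h2 : Disjoint l.1.toFinset S)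
    (h3 : Disjoint l.2.toFinset S) (h4 : Disjoint r.1.toFinset r.2.toFinset)
    (h5 : r.1.toFinset ∪ r.2.toFinset ⊆ l.1.toFinset ∪ l.2.toFinset ∪ S) :
    rDiag q x₁ x₂ l * barePair q (x₁ * w) (x₂ * w) S l r
        + rSwap q x₁ x₂ l * barePair q (x₁ * w) (x₂ * w) S l.swap r
      = barePair q (x₂ * w) (x₁ * w) S l r * rDiag q x₁ x₂ r
        + barePair q (x₂ * w) (x₁ * w) S l r.swap * rSwap q x₁ x₂ r.swap := by
  simp only [barePair_eq]
  rcases l with ⟨_ | a, _ | b⟩ <;> rcases r with ⟨_ | c, _ | d⟩ <;>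
    simp only [Option.toFinset_none, Option.toFinset_some, Finset.disjoint_singleton_left,
      Finset.union_subset_iff, Finset.singleton_subset_iff, Finset.mem_union, Finset.mem_singleton,
      Finset.notMem_empty, false_or, or_false, Finset.empty_subset, true_and, and_true]
      at h1 h2 h3 h4 h5 <;>
    simp only [Prod.swap, Option.toFinset_none, Option.toFinset_some, Finset.prod_singleton,
      Finset.prod_empty, Finset.mem_singleton, Finset.notMem_empty, forall_eq, false_or, or_false,
      or_self, if_false, if_true, IsEmpty.forall_iff, implies_true]
  · simp [bareWeight, rDiag, rSwap]
  · simp [*, bareWeight, rDiag, rSwap, leftFactor, rightFactor] <;> ring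
  · simp [*, bareWeight, rDiag, rSwap, leftFactor, rightFactor] <;> ring
  · obtain ⟨h5, h6⟩ := h5
    rcases lt_cases_of_ne (show c ≠ d by grind) with ⟨_, _, _, _⟩ | ⟨_, _, _, _⟩ <;>
      simp [*, bareWeight, rDiag, rSwap, leftFactor, rightFactor] <;> ring
  · simp [*, bareWeight, rDiag, rSwap, leftFactor, rightFactor] <;> ring
  · rcases h5 with rfl | h5
    · simp [*, bareWeight, rDiag, rSwap, leftFactor, rightFactor] <;> ring
    · rcases lt_cases_of_ne (show b ≠ d by grind) with ⟨_, _, _, _⟩ | ⟨_, _, _, _⟩ <;>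
        simp [*, bareWeight, rDiag, rSwap, leftFactor, rightFactor] <;> ring
  · rcases h5 with rfl | h5
    · simp [*, bareWeight, rDiag, rSwap, leftFactor, rightFactor] <;> ring
    · rcases lt_cases_of_ne (show b ≠ c by grind) with ⟨_, _, _, _⟩ | ⟨_, _, _, _⟩ <;>
        simp [*, bareWeight, rDiag, rSwap, leftFactor, rightFactor] <;> ring
  · obtain ⟨h5, h6⟩ := h5
    rcases h5 with rfl | h5
    · rcases h6 with rfl | h6
      · exact absurd rfl h4
      · rcases lt_cases_of_ne (show c ≠ d by grind) with ⟨_, _, _, _⟩ | ⟨_, _, _, _⟩ <;>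
          simp [*, bareWeight, rDiag, rSwap, leftFactor, rightFactor] <;> ring
    · rcases h6 with rfl | h6
      · rcases lt_cases_of_ne (show d ≠ c by grind) with ⟨_, _, _, _⟩ | ⟨_, _, _, _⟩ <;>
          simp [*, bareWeight, rDiag, rSwap, leftFactor, rightFactor] <;> ring
      · rcases lt_cases_of_ne (show b ≠ c by grind) with ⟨_, _, _, _⟩ | ⟨_, _, _, _⟩ <;>
          rcases lt_cases_of_ne (show b ≠ d by grind) with ⟨_, _, _, _⟩ | ⟨_, _, _, _⟩ <;>
          rcases lt_cases_of_ne (show c ≠ d by grind) with ⟨_, _, _, _⟩ | ⟨_, _, _, _⟩ <;>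
          first
          | (exfalso; order)
          | (simp [*, bareWeight, rDiag, rSwap, leftFactor, rightFactor] <;> ring)
  · simp [*, bareWeight, rDiag, rSwap, leftFactor, rightFactor] <;> ring
  · rcases h5 with rfl | h5
    · simp [*, bareWeight, rDiag, rSwap, leftFactor, rightFactor] <;> ring
    · rcases lt_cases_of_ne (show a ≠ d by grind) with ⟨_, _, _, _⟩ | ⟨_, _, _, _⟩ <;>
        simp [*, bareWeight, rDiag, rSwap, leftFactor, rightFactor] <;> ring
  · rcases h5 with rfl | h5
    · simp [*, bareWeight, rDiag, rSwap, leftFactor, rightFactor] <;> ring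
    · rcases lt_cases_of_ne (show a ≠ c by grind) with ⟨_, _, _, _⟩ | ⟨_, _, _, _⟩ <;>
        simp [*, bareWeight, rDiag, rSwap, leftFactor, rightFactor] <;> ring
  · obtain ⟨h5, h6⟩ := h5
    rcases h5 with rfl | h5
    · rcases h6 with rfl | h6
      · exact absurd rfl h4
      · rcases lt_cases_of_ne (show c ≠ d by grind) with ⟨_, _, _, _⟩ | ⟨_, _, _, _⟩ <;>
          simp [*, bareWeight, rDiag, rSwap, leftFactor, rightFactor] <;> ring
    · rcases h6 with rfl | h6
      · rcases lt_cases_of_ne (show d ≠ c by grind) with ⟨_, _, _, _⟩ | ⟨_, _, _, _⟩ <;>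
          simp [*, bareWeight, rDiag, rSwap, leftFactor, rightFactor] <;> ring
      · rcases lt_cases_of_ne (show a ≠ c by grind) with ⟨_, _, _, _⟩ | ⟨_, _, _, _⟩ <;>
          rcases lt_cases_of_ne (show a ≠ d by grind) with ⟨_, _, _, _⟩ | ⟨_, _, _, _⟩ <;>
          rcases lt_cases_of_ne (show c ≠ d by grind) with ⟨_, _, _, _⟩ | ⟨_, _, _, _⟩ <;>
          first
          | (exfalso; order)
          | (simp [*, bareWeight, rDiag, rSwap, leftFactor, rightFactor] <;> ring)
  · rcases lt_cases_of_ne (show a ≠ b by grind) with ⟨_, _, _, _⟩ | ⟨_, _, _, _⟩ <;>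
      simp [*, bareWeight, rDiag, rSwap, leftFactor, rightFactor] <;> ring
  · rcases h5 with (rfl | rfl) | h5
    · rcases lt_cases_of_ne (show d ≠ b by grind) with ⟨_, _, _, _⟩ | ⟨_, _, _, _⟩ <;>
        simp [*, bareWeight, rDiag, rSwap, leftFactor, rightFactor] <;> ring
    · rcases lt_cases_of_ne (show a ≠ d by grind) with ⟨_, _, _, _⟩ | ⟨_, _, _, _⟩ <;>
        simp [*, bareWeight, rDiag, rSwap, leftFactor, rightFactor] <;> ring
    · rcases lt_cases_of_ne (show a ≠ b by grind) with ⟨_, _, _, _⟩ | ⟨_, _, _, _⟩ <;>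
        rcases lt_cases_of_ne (show a ≠ d by grind) with ⟨_, _, _, _⟩ | ⟨_, _, _, _⟩ <;>
        rcases lt_cases_of_ne (show b ≠ d by grind) with ⟨_, _, _, _⟩ | ⟨_, _, _, _⟩ <;>
        first
        | (exfalso; order)
        | (simp [*, bareWeight, rDiag, rSwap, leftFactor, rightFactor] <;> ring)
  · rcases h5 with (rfl | rfl) | h5
    · rcases lt_cases_of_ne (show c ≠ b by grind) with ⟨_, _, _, _⟩ | ⟨_, _, _, _⟩ <;>
        simp [*, bareWeight, rDiag, rSwap, leftFactor, rightFactor] <;> ring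
    · rcases lt_cases_of_ne (show a ≠ c by grind) with ⟨_, _, _, _⟩ | ⟨_, _, _, _⟩ <;>
        simp [*, bareWeight, rDiag, rSwap, leftFactor, rightFactor] <;> ring
    · rcases lt_cases_of_ne (show a ≠ b by grind) with ⟨_, _, _, _⟩ | ⟨_, _, _, _⟩ <;>
        rcases lt_cases_of_ne (show a ≠ c by grind) with ⟨_, _, _, _⟩ | ⟨_, _, _, _⟩ <;>
        rcases lt_cases_of_ne (show b ≠ c by grind) with ⟨_, _, _, _⟩ | ⟨_, _, _, _⟩ <;>
        first
        | (exfalso; order)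
        | (simp [*, bareWeight, rDiag, rSwap, leftFactor, rightFactor] <;> ring)
  · obtain ⟨h5, h6⟩ := h5
    rcases h5 with (rfl | rfl) | h5
    · rcases h6 with (rfl | rfl) | h6
      · exact absurd rfl h4
      · rcases lt_cases_of_ne (show c ≠ d by grind) with ⟨_, _, _, _⟩ | ⟨_, _, _, _⟩ <;>
          simp [*, bareWeight, rDiag, rSwap, leftFactor, rightFactor] <;> ring
      · rcases lt_cases_of_ne (show c ≠ b by grind) with ⟨_, _, _, _⟩ | ⟨_, _, _, _⟩ <;>
          rcases lt_cases_of_ne (show c ≠ d by grind) with ⟨_, _, _, _⟩ | ⟨_, _, _, _⟩ <;>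
          rcases lt_cases_of_ne (show b ≠ d by grind) with ⟨_, _, _, _⟩ | ⟨_, _, _, _⟩ <;>
          first
          | (exfalso; order)
          | (simp [*, bareWeight, rDiag, rSwap, leftFactor, rightFactor] <;> ring)
    · rcases h6 with (rfl | rfl) | h6
      · rcases lt_cases_of_ne (show d ≠ c by grind) with ⟨_, _, _, _⟩ | ⟨_, _, _, _⟩ <;>
          simp [*, bareWeight, rDiag, rSwap, leftFactor, rightFactor] <;> ring
      · exact absurd rfl h4
      · rcases lt_cases_of_ne (show a ≠ c by grind) with ⟨_, _, _, _⟩ | ⟨_, _, _, _⟩ <;>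
          rcases lt_cases_of_ne (show a ≠ d by grind) with ⟨_, _, _, _⟩ | ⟨_, _, _, _⟩ <;>
          rcases lt_cases_of_ne (show c ≠ d by grind) with ⟨_, _, _, _⟩ | ⟨_, _, _, _⟩ <;>
          first
          | (exfalso; order)
          | (simp [*, bareWeight, rDiag, rSwap, leftFactor, rightFactor] <;> ring)
    · rcases h6 with (rfl | rfl) | h6
      · rcases lt_cases_of_ne (show d ≠ b by grind) with ⟨_, _, _, _⟩ | ⟨_, _, _, _⟩ <;>
          rcases lt_cases_of_ne (show d ≠ c by grind) with ⟨_, _, _, _⟩ | ⟨_, _, _, _⟩ <;>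
          rcases lt_cases_of_ne (show b ≠ c by grind) with ⟨_, _, _, _⟩ | ⟨_, _, _, _⟩ <;>
          first
          | (exfalso; order)
          | (simp [*, bareWeight, rDiag, rSwap, leftFactor, rightFactor] <;> ring)
      · rcases lt_cases_of_ne (show a ≠ d by grind) with ⟨_, _, _, _⟩ | ⟨_, _, _, _⟩ <;>
          rcases lt_cases_of_ne (show a ≠ c by grind) with ⟨_, _, _, _⟩ | ⟨_, _, _, _⟩ <;>
          rcases lt_cases_of_ne (show d ≠ c by grind) with ⟨_, _, _, _⟩ | ⟨_, _, _, _⟩ <;>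
          first
          | (exfalso; order)
          | (simp [*, bareWeight, rDiag, rSwap, leftFactor, rightFactor] <;> ring)
      · rcases lt_cases_of_ne (show a ≠ b by grind) with ⟨_, _, _, _⟩ | ⟨_, _, _, _⟩ <;>
          rcases lt_cases_of_ne (show a ≠ c by grind) with ⟨_, _, _, _⟩ | ⟨_, _, _, _⟩ <;>
          rcases lt_cases_of_ne (show a ≠ d by grind) with ⟨_, _, _, _⟩ | ⟨_, _, _, _⟩ <;>
          rcases lt_cases_of_ne (show b ≠ c by grind) with ⟨_, _, _, _⟩ | ⟨_, _, _, _⟩ <;>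
          rcases lt_cases_of_ne (show b ≠ d by grind) with ⟨_, _, _, _⟩ | ⟨_, _, _, _⟩ <;>
          rcases lt_cases_of_ne (show c ≠ d by grind) with ⟨_, _, _, _⟩ | ⟨_, _, _, _⟩ <;>
          first
          | (exfalso; order)
          | (simp [*, bareWeight, rDiag, rSwap, leftFactor, rightFactor] <;> ring)

end YangBaxterBare


/-! ### The train argument -/

section Train

variable {n : ℕ} {K : Type*} [Field K]

/-- The R-matrix only keeps or exchanges its two labels, so two families of entries, `rDiag` and
`rSwap`, suffice to state the equation. -/
theorem pairWeight_yangBaxter (q x₁ x₂ y : K) (S B : Finset (Fin n))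
    (l r : Option (Fin n) × Option (Fin n))
    (h1 : Disjoint l.1.toFinset l.2.toFinset) (h2 : Disjoint l.1.toFinset S)
    (h3 : Disjoint l.2.toFinset S) :
    rDiag q x₁ x₂ l * pairWeight q x₁ x₂ y S B l r
        + rSwap q x₁ x₂ l * pairWeight q x₁ x₂ y S B l.swap r
      = pairWeight q x₂ x₁ y S B l r * rDiag q x₁ x₂ r
        + pairWeight q x₂ x₁ y S B l r.swap * rSwap q x₁ x₂ r.swap := by
  rw [pairWeight_eq q x₁ x₂ y S B l r h1 h2 h3, pairWeight_eq q x₁ x₂ y S B l.swap r h1.symm h3 h2,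
    pairWeight_eq q x₂ x₁ y S B l r h1 h2 h3, pairWeight_eq q x₂ x₁ y S B l r.swap h1 h2 h3]
  simp only [Prod.fst_swap, Prod.snd_swap, disjoint_comm (a := r.2.toFinset),
    Finset.union_comm r.2.toFinset, Finset.union_comm l.2.toFinset,
    mul_comm (leftFactor q l.2 _), mul_comm (rightFactor r.2 _)]
  split_ifs with h
  · have := barePair_yangBaxter q x₁ x₂ y⁻¹ S l r h1 h2 h3 h.1 h.2.1
    linear_combination (∏ e ∈ S \ (r.1.toFinset ∪ r.2.toFinset),
      leftFactor q l.1 e * leftFactor q l.2 e * (rightFactor r.1 e * rightFactor r.2 e)) * this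
  · simp

theorem pairWeight_conserve (q x₁ x₂ y : K) (S B : Finset (Fin n))
    (l r : Option (Fin n) × Option (Fin n)) (h : pairWeight q x₁ x₂ y S B l r ≠ 0) (c : Fin n) :
    (if c ∈ B then 1 else 0) + ((if c ∈ r.1 then 1 else 0) + (if c ∈ r.2 then 1 else 0))
      = (if c ∈ S then 1 else 0) + ((if c ∈ l.1 then 1 else 0) + (if c ∈ l.2 then 1 else (0 : ℕ))) := by
  obtain ⟨M, -, hM⟩ := Finset.exists_ne_zero_of_sum_ne_zero h
  have h1 := kWeight_conserve _ _ _ _ _ _ _ (left_ne_zero_of_mul hM) c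
  have h2 := kWeight_conserve _ _ _ _ _ _ _ (right_ne_zero_of_mul hM) c
  omega

/-- The joint weight of two vertically adjacent rows with `k` columns. -/
def rowPair (q x₁ x₂ : K) (y : ℕ → K) (S B : ℕ → Finset (Fin n)) (k : ℕ)
    (l r : Option (Fin n) × Option (Fin n)) : K :=
  pathSum (fun j r l => pairWeight q x₁ x₂ (y j) (S j) (B j) l r) k r l

/-- The train argument. -/
theorem rowPair_yangBaxter (q x₁ x₂ : K) (y : ℕ → K) (S B : ℕ → Finset (Fin n)) (k : ℕ)
    (l r : Option (Fin n) × Option (Fin n))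
    (hl : ∀ c, (if c ∈ l.1 then 1 else 0) + (if c ∈ l.2 then 1 else 0)
      + ∑ j ∈ Finset.range k, (if c ∈ S j then 1 else 0) ≤ 1) :
    rDiag q x₁ x₂ l * rowPair q x₁ x₂ y S B k l r
        + rSwap q x₁ x₂ l * rowPair q x₁ x₂ y S B k l.swap r
      = rowPair q x₂ x₁ y S B k l r * rDiag q x₁ x₂ r
        + rowPair q x₂ x₁ y S B k l r.swap * rSwap q x₁ x₂ r.swap := by
  induction k generalizing l with
  | zero =>
    simp only [rowPair, pathSum]
    by_cases h : r = l
    · subst h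
      by_cases h' : r = r.swap
      · rw [← h']; simp
      · simp [h', Ne.symm h', mul_comm]
    · by_cases h' : r = l.swap
      · subst h'; simp [h, mul_comm]
      · have : r.swap ≠ l := fun h'' => h' (by rw [← h'', Prod.swap_swap])
        simp [h, h', this]
  | succ k ih =>
    have hd : ∀ c, _ := hl
    simp only [Finset.sum_range_succ] at hd
    have h1 : Disjoint l.1.toFinset l.2.toFinset := by
      rw [Finset.disjoint_left]
      intro c hc1 hc2
      have := hd c
      simp only [Option.mem_toFinset] at hc1 hc2
      rw [if_pos hc1, if_pos hc2] at this
      omega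
    have h2 : Disjoint l.1.toFinset (S k) := by
      rw [Finset.disjoint_left]
      intro c hc1 hc2
      have := hd c
      simp only [Option.mem_toFinset] at hc1
      rw [if_pos hc1, if_pos hc2] at this
      omega
    have h3 : Disjoint l.2.toFinset (S k) := by
      rw [Finset.disjoint_left]
      intro c hc1 hc2
      have := hd c
      simp only [Option.mem_toFinset] at hc1
      rw [if_pos hc1, if_pos hc2] at this
      omega
    have step : ∀ x₁ x₂ l r, rowPair q x₁ x₂ y S B (k + 1) l r
        = ∑ m, rowPair q x₁ x₂ y S B k m r * pairWeight q x₁ x₂ (y k) (S k) (B k) l m :=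
      fun _ _ _ _ => rfl
    -- Exchanging the two internal labels collects the R-matrix entries by the labels to its left,
    -- ready for the next column.
    have reindex : ∑ m, rowPair q x₁ x₂ y S B k m r
          * (pairWeight q x₂ x₁ (y k) (S k) (B k) l m.swap * rSwap q x₁ x₂ m.swap)
        = ∑ m : Option (Fin n) × Option (Fin n), rowPair q x₁ x₂ y S B k m.swap r
          * (pairWeight q x₂ x₁ (y k) (S k) (B k) l m * rSwap q x₁ x₂ m) :=
      ((Equiv.prodComm _ _).sum_comp fun m : Option (Fin n) × Option (Fin n) =>
        rowPair q x₁ x₂ y S B k m.swap r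
          * (pairWeight q x₂ x₁ (y k) (S k) (B k) l m * rSwap q x₁ x₂ m))
    calc _ = ∑ m, rowPair q x₁ x₂ y S B k m r
            * (rDiag q x₁ x₂ l * pairWeight q x₁ x₂ (y k) (S k) (B k) l m
              + rSwap q x₁ x₂ l * pairWeight q x₁ x₂ (y k) (S k) (B k) l.swap m) := by
          simp only [step, Finset.mul_sum, ← Finset.sum_add_distrib]
          exact Finset.sum_congr rfl fun m _ => by ring
      _ = ∑ m : Option (Fin n) × Option (Fin n), pairWeight q x₂ x₁ (y k) (S k) (B k) l m
            * (rDiag q x₁ x₂ m * rowPair q x₁ x₂ y S B k m r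
              + rSwap q x₁ x₂ m * rowPair q x₁ x₂ y S B k m.swap r) := by
          simp only [pairWeight_yangBaxter q x₁ x₂ (y k) (S k) (B k) l _ h1 h2 h3, mul_add,
            Finset.sum_add_distrib, reindex]
          congr 1 <;> exact Finset.sum_congr rfl fun m _ => by ring
      _ = ∑ m : Option (Fin n) × Option (Fin n), pairWeight q x₂ x₁ (y k) (S k) (B k) l m
            * (rowPair q x₂ x₁ y S B k m r * rDiag q x₁ x₂ r
              + rowPair q x₂ x₁ y S B k m r.swap * rSwap q x₁ x₂ r.swap) := by
          refine Finset.sum_congr rfl fun m _ => ?_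
          -- Column `k` is the leftmost one. Where its weight is nonzero, conservation passes the
          -- multiplicity bound from `l` to `m`, as the induction hypothesis requires.
          by_cases hm : pairWeight q x₂ x₁ (y k) (S k) (B k) l m = 0
          · simp [hm]
          · rw [ih m fun c => ?_]
            have := pairWeight_conserve _ _ _ _ _ _ _ _ hm c
            have := hd c
            omega
      _ = _ := by
          simp only [step, Finset.sum_mul, ← Finset.sum_add_distrib]
          exact Finset.sum_congr rfl fun m _ => by ring

end Train


/-! ### The partition function as a path sum and its exchange relation -/

section Transfer

variable {n : ℕ} {K : Type*} [Field K]

/-- The extension of a finite sequence to all indices, with the value `d` at the new indices. -/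
def extend {α : Type*} {m : ℕ} (d : α) (f : Fin m → α) (k : ℕ) : α :=
  if h : k < m then f ⟨k, h⟩ else d

@[simp]
theorem extend_coe {α : Type*} {m : ℕ} (d : α) (f : Fin m → α) (k : Fin m) :
    extend d f k = f k := by
  simp [extend]

theorem extend_snoc_of_lt {α : Type*} {m : ℕ} (d : α) (f : Fin m → α) (a : α) {k : ℕ} (h : k < m) :
    extend d (Fin.snoc f a : Fin (m + 1) → α) k = extend d f k := by
  rw [extend, dif_pos (by omega), extend, dif_pos h]
  exact Fin.snoc_castSucc (α := fun _ => α) a f ⟨k, h⟩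

theorem extend_snoc_self {α : Type*} {m : ℕ} (d : α) (f : Fin m → α) (a : α) :
    extend d (Fin.snoc f a : Fin (m + 1) → α) m = a := by
  rw [extend, dif_pos (by omega)]
  exact Fin.snoc_last (α := fun _ => α) a f

/-- Given the horizontal labels, the sum over the edges between two rows splits column by column.
The default `d` is never read, since only indices below `m` occur. -/
theorem sum_pathSum_mul_pathSum {ι β R : Type*} [Fintype ι] [DecidableEq ι] [Fintype β]
    [CommSemiring R] (d : β) (A B : ℕ → β → ι → ι → R) (m : ℕ) (r l : ι × ι) :
    ∑ U : Fin m → β, pathSum (fun j => A j (extend d U j)) m r.1 l.1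
        * pathSum (fun j => B j (extend d U j)) m r.2 l.2
      = pathSum (fun j (r l : ι × ι) => ∑ M, A j M r.1 l.1 * B j M r.2 l.2) m r l := by
  induction m generalizing l with
  | zero =>
    simp only [pathSum, Prod.ext_iff]
    by_cases h1 : r.1 = l.1 <;> by_cases h2 : r.2 = l.2 <;> simp [h1, h2]
  | succ m ih =>
    rw [← (Fin.snocEquiv fun _ : Fin (m + 1) => β).sum_comp, Fintype.sum_prod_type]
    have hA : ∀ (C : ℕ → β → ι → ι → R) (U : Fin m → β) (a : β),
        pathSum (fun j => C j (extend d ((Fin.snocEquiv fun _ : Fin (m + 1) => β) (a, U)) j)) m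
          = pathSum (fun j => C j (extend d U j)) m := fun C U a =>
      pathSum_congr fun j hj => by
        rw [← extend_snoc_of_lt d U a hj]; rfl
    have hB : ∀ (U : Fin m → β) (a : β),
        extend d ((Fin.snocEquiv fun _ : Fin (m + 1) => β) (a, U)) m = a := fun U a =>
      extend_snoc_self d U a
    simp only [pathSum, hA, hB, ← ih]
    simp only [Finset.sum_mul_sum, Fintype.sum_prod_type]
    rw [Finset.sum_comm]
    refine Eq.trans (b := ∑ U : Fin m → β, ∑ c₁ : ι, ∑ c₂ : ι, ∑ M : β,
      pathSum (fun j => A j (extend d U j)) m r.1 c₁ * A m M c₁ l.1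
        * (pathSum (fun j => B j (extend d U j)) m r.2 c₂ * B m M c₂ l.2)) ?_ ?_
    · refine Finset.sum_congr rfl fun U _ => ?_
      rw [Finset.sum_comm]
      refine Finset.sum_congr rfl fun c₁ _ => ?_
      rw [Finset.sum_comm]
    · rw [Finset.sum_comm]
      refine Finset.sum_congr rfl fun c₁ _ => ?_
      rw [Finset.sum_comm]
      refine Finset.sum_congr rfl fun c₂ _ => Finset.sum_congr rfl fun U _ =>
        Finset.sum_congr rfl fun M _ => ?_
      ring

/-- The weight of a row with right label `r` and uncolored left boundary, with the vertical labels
`V` above and `V'` below. -/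
def rowWeight (q x : K) (y : Fin n → K) (r : Option (Fin n)) (V V' : Fin n → Finset (Fin n)) : K :=
  pathSum (fun j r l => kWeight q x (extend 0 y j) l (extend ∅ V j) r (extend ∅ V' j)) n r none

theorem sum_rowWeight_mul_rowWeight (q x₁ x₂ : K) (y : Fin n → K) (r₁ r₂ : Option (Fin n))
    (V V' : Fin n → Finset (Fin n)) :
    ∑ U, rowWeight q x₁ y r₁ V U * rowWeight q x₂ y r₂ U V'
      = rowPair q x₁ x₂ (extend 0 y) (extend ∅ V) (extend ∅ V') n (none, none) (r₁, r₂) :=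
  sum_pathSum_mul_pathSum (∅ : Finset (Fin n))
    (fun j U r l => kWeight q x₁ (extend 0 y j) l (extend ∅ V j) r U)
    (fun j U r l => kWeight q x₂ (extend 0 y j) l U r (extend ∅ V' j)) n (r₁, r₂) (none, none)

theorem rowWeight_conserve (q x : K) (y : Fin n → K) (r : Option (Fin n))
    (V V' : Fin n → Finset (Fin n)) (h : rowWeight q x y r V V' ≠ 0) (c : Fin n) :
    ∑ j ∈ Finset.range n, (if c ∈ extend ∅ V' j then 1 else 0) + (if c ∈ r then 1 else 0)
      = ∑ j ∈ Finset.range n, (if c ∈ extend ∅ V j then 1 else (0 : ℕ)) := by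
  have key : ∀ k l,
      pathSum (fun j r l => kWeight q x (extend 0 y j) l (extend ∅ V j) r (extend ∅ V' j)) k r l ≠ 0 →
      ∑ j ∈ Finset.range k, (if c ∈ extend ∅ V' j then 1 else 0) + (if c ∈ r then 1 else 0)
        = ∑ j ∈ Finset.range k, (if c ∈ extend ∅ V j then 1 else 0)
          + (if c ∈ l then 1 else (0 : ℕ)) := by
    intro k
    induction k with
    | zero =>
      intro l hl
      by_cases hrl : r = l
      · simp [hrl]
      · simp [pathSum, hrl] at hl
    | succ k ih =>
      intro l hl
      obtain ⟨m, -, hm⟩ := Finset.exists_ne_zero_of_sum_ne_zero hl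
      have h1 := ih m (left_ne_zero_of_mul hm)
      have h2 := kWeight_conserve _ _ _ _ _ _ _ (right_ne_zero_of_mul hm) c
      rw [Finset.sum_range_succ, Finset.sum_range_succ]
      omega
  simpa using key n none h

/-- The row-to-row transfer weights of the model with right boundary `w`. -/
def transfer (q : K) (x y : Fin n → K) (w : Equiv.Perm (Fin n)) (i : ℕ)
    (V V' : Fin n → Finset (Fin n)) : K :=
  rowWeight q (extend 0 x i) y (extend none (fun i => some (w i)) i) V V'

/-- Each color enters once at the top and can only leave to the right. This supplies the
multiplicity hypothesis of the train argument. -/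
theorem pathSum_transfer_regular (q : K) (x y : Fin n → K) (w : Equiv.Perm (Fin n)) (k : ℕ)
    (V : Fin n → Finset (Fin n)) (h : pathSum (transfer q x y w) k (fun j => {j}) V ≠ 0)
    (c : Fin n) : ∑ j ∈ Finset.range n, (if c ∈ extend ∅ V j then 1 else 0) ≤ 1 := by
  induction k generalizing V with
  | zero =>
    have : (fun j : Fin n => ({j} : Finset (Fin n))) = V := by
      by_contra hV
      simp [pathSum, hV] at h
    subst this
    rw [Finset.sum_range]
    simp
  | succ k ih =>
    obtain ⟨U, -, hU⟩ := Finset.exists_ne_zero_of_sum_ne_zero h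
    have h1 := ih U (left_ne_zero_of_mul hU)
    have h2 := rowWeight_conserve _ _ _ _ _ _ (right_ne_zero_of_mul hU) c
    omega

theorem Zsq_eq_pathSum (q : K) (x y : Fin n → K) (w : Equiv.Perm (Fin n)) :
    Zsq q 1 w x y = pathSum (transfer q x y w) n (fun j => {j}) (fun _ => ∅) := by
  classical
  rw [Zsq, partitionFunction, Finset.sum_filter, Fintype.sum_prod_type, Finset.sum_comm, ← sum_paths]
  refine Finset.sum_congr rfl fun V _ => ?_
  have hB : ∀ h : Fin n → Fin (n + 1) → Option (Fin n), HasBoundary 1 w (h, V) ↔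
      (V 0 = (fun j => {j}) ∧ V (Fin.last n) = fun _ => ∅) ∧
        ∀ i ∈ Finset.univ, h i 0 = some (w i) ∧ h i (Fin.last n) = none := by
    intro h
    simp only [HasBoundary, Equiv.Perm.one_apply, funext_iff, Finset.mem_univ, true_imp_iff,
      forall_and]
    tauto
  simp only [hB]
  by_cases hV : V 0 = (fun j => {j}) ∧ V (Fin.last n) = fun _ => ∅
  swap
  · simp [hV]
  simp only [hV, true_and, if_true, and_self]
  have h1 : ∀ i : Fin n, transfer q x y w i (V i.castSucc) (V i.succ)
      = ∑ h : Fin (n + 1) → Option (Fin n), if h 0 = some (w i) ∧ h (Fin.last n) = none then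
          ∏ j : Fin n, kWeight q (x i) (y j) (h j.succ) (V i.castSucc j) (h j.castSucc)
            (V i.succ j) else 0 := by
    intro i
    simp only [transfer, rowWeight, ← sum_paths, extend_coe]
  -- Once the vertical labels are fixed, the rows are independent: the product of the row sums is
  -- the sum over all horizontal labels.
  simp only [h1, Finset.prod_univ_sum, Fintype.piFinset_univ, Finset.prod_ite_zero]
  refine Finset.sum_congr rfl fun h _ => ?_
  congr

theorem extend_lo {α : Type*} (d : α) (f : Fin n → α) (i : Fin (n - 1)) :
    extend d f i = f (lo i) :=
  extend_coe d f (lo i)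

theorem extend_hi {α : Type*} (d : α) (f : Fin n → α) (i : Fin (n - 1)) :
    extend d f (i + 1) = f (hi i) :=
  extend_coe d f (hi i)

theorem extend_simpleRefl_of_ne {α : Type*} (d : α) (f : Fin n → α) (i : Fin (n - 1)) {j : ℕ}
    (h1 : j ≠ i) (h2 : j ≠ i + 1) : extend d (fun k => f (simpleRefl i k)) j = extend d f j := by
  unfold extend
  split_ifs with h
  · refine congrArg f (Equiv.swap_apply_of_ne_of_ne ?_ ?_)
    · exact fun h' => h1 (congrArg Fin.val h')
    · exact fun h' => h2 (congrArg Fin.val h')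
  · rfl

theorem Zsq_relation (q : K) (x y : Fin n → K) (w : Equiv.Perm (Fin n)) (i : Fin (n - 1))
    (hw : w (hi i) < w (lo i)) :
    (x (hi i) - q * x (lo i)) * Zsq q 1 w x y
      = (1 - q) * x (lo i) * Zsq q 1 w (fun k => x (simpleRefl i k)) y
        + (x (lo i) - x (hi i)) * Zsq q 1 (w * simpleRefl i) (fun k => x (simpleRefl i k)) y := by
  simp only [Zsq_eq_pathSum]
  have hi' := i.isLt
  refine pathSum_relation (k := i) (by omega) ?_ ?_ ?_ _
  · intro j h1 h2
    ext V V'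
    simp only [transfer, extend_simpleRefl_of_ne _ _ i h1 h2]
  · intro j h1 h2
    ext V V'
    simp only [transfer, extend_simpleRefl_of_ne _ _ i h1 h2, Equiv.Perm.mul_apply]
    rw [extend_simpleRefl_of_ne none (fun k => some (w k)) i h1 h2]
  · intro V hV V'
    have hreg := pathSum_transfer_regular _ _ _ _ _ _ hV
    have := rowPair_yangBaxter q (x (lo i)) (x (hi i)) (extend 0 y) (extend ∅ V) (extend ∅ V') n
      (none, none) (some (w (lo i)), some (w (hi i))) (by simpa using hreg)
    -- On the uncolored left boundary `rSwap` is zero and `rDiag` is the scalar `x₂ - q x₁`; on the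
    -- right the descent of `w` selects the entries.
    simp only [rDiag, rSwap, Prod.swap, hw.not_gt, hw, if_true, if_false, zero_mul, add_zero] at this
    simp only [transfer, extend_lo, extend_hi, simpleRefl_lo, simpleRefl_hi, Equiv.Perm.mul_apply,
      sum_rowWeight_mul_rowWeight]
    linear_combination this

end Transfer


/-! ### The model for the longest permutation -/

section LongestElement

variable {n : ℕ} {K : Type*} [Field K]

theorem kWeight_none_empty (q x y : K) (m : Option (Fin n)) (B : Finset (Fin n)) :
    kWeight q x y none ∅ m B = if m = none ∧ B = ∅ then 1 else 0 := by
  rcases m with _ | c <;> simp [kWeight]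

theorem kWeight_singleton_of_ne (q x y : K) (l : Option (Fin n)) {c d : Fin n} (h : d < c)
    (B : Finset (Fin n)) :
    kWeight q x y l {d} (some c) B = if l = some c ∧ B = {d} then 1 - x * y⁻¹ else 0 := by
  rcases l with _ | a
  · simp [kWeight, h.ne']
  · by_cases hac : a = c
    · subst hac
      have h1 : ({d} : Finset (Fin n)).filter (a < ·) = ∅ := by
        rw [Finset.filter_singleton, if_neg h.not_gt]
      have h2 : ({d} : Finset (Fin n)).filter (· = a) = ∅ := by
        rw [Finset.filter_singleton, if_neg h.ne]
      simp only [kWeight, if_true, h1, h2, true_and, Finset.card_empty, pow_zero, one_mul]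
      exact if_congr Iff.rfl (by ring) rfl
    · simp [kWeight, hac, h.ne']

theorem kWeight_none_singleton (q x y : K) (c : Fin n) (B : Finset (Fin n)) :
    kWeight q x y none {c} (some c) B = if B = ∅ then 1 else 0 := by
  simp [kWeight, Finset.filter_singleton]

/-- The weight of a row in which the color of the column `c` leaves to the right, while the columns
to the right of `c` carry their own colors and those to the left carry none. -/
theorem rowWeight_straight (q x : K) (y : Fin n → K) (c : Fin n) (V V' : Fin n → Finset (Fin n))
    (hV : ∀ j, V j = if j ≤ c then {j} else ∅) :
    rowWeight q x y (some c) V V' =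
      if ∀ j, V' j = (V j).erase c then ∏ j with j < c, (1 - x * (y j)⁻¹) else 0 := by
  have hS : ∀ j : Fin n, extend ∅ V j = if j ≤ c then {j} else ∅ := fun j => by
    rw [extend_coe, hV]
  -- Read from the right boundary: before column `c` no top edge carries `c`, so the path must come
  -- from further left.
  have right : ∀ k ≤ (c : ℕ), ∀ l,
      pathSum (fun j r l => kWeight q x (extend 0 y j) l (extend ∅ V j) r (extend ∅ V' j)) k
        (some c) l = if l = some c ∧ ∀ j : Fin n, (j : ℕ) < k → V' j = (V j).erase c then
          ∏ j ∈ Finset.univ.filter (fun j : Fin n => (j : ℕ) < k), (1 - x * (y j)⁻¹) else 0 := by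
    intro k
    induction k with
    | zero => intro _ l; simp [pathSum, eq_comm]
    | succ k ih =>
      intro hk l
      have hkn : k < n := lt_of_lt_of_le hk c.isLt.le
      set k' : Fin n := ⟨k, hkn⟩ with hk'
      have hkc : k' < c := hk
      have hfil : (Finset.univ.filter fun j : Fin n => (j : ℕ) < k + 1)
          = insert k' (Finset.univ.filter fun j : Fin n => (j : ℕ) < k) := by
        ext j
        simp only [Finset.mem_filter, Finset.mem_univ, true_and, Finset.mem_insert, Fin.ext_iff, hk']
        omega
      have e0 := hS k'
      have e1 := extend_coe ∅ V' k'
      have e2 := extend_coe 0 y k'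
      rw [if_pos hkc.le] at e0
      simp only [hk'] at e0 e1 e2
      have hforall : (∀ j : Fin n, (j : ℕ) < k + 1 → V' j = (V j).erase c) ↔
          (∀ j : Fin n, (j : ℕ) < k → V' j = (V j).erase c) ∧ V' k' = {k'} := by
        have hVk : (V k').erase c = {k'} := by
          rw [hV, if_pos hkc.le, Finset.erase_eq_of_notMem]
          simpa using hkc.ne'
        constructor
        · exact fun h => ⟨fun j hj => h j (by omega), by rw [h k' (by simp [hk']), hVk]⟩
        · rintro ⟨h1, h2⟩ j hj
          by_cases hjk : j = k'
          · rw [hjk, h2, hVk]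
          · exact h1 j (lt_of_le_of_ne (Nat.lt_succ_iff.1 hj) fun h => hjk (Fin.ext h))
      simp only [pathSum, ih (by omega), e0, e1, e2]
      rw [Finset.sum_eq_single (some c)]
      · rw [← hk', kWeight_singleton_of_ne _ _ _ _ hkc, hfil, Finset.prod_insert (by simp [hk'])]
        simp only [hforall]
        by_cases h1 : l = some c <;> by_cases h2 : V' k' = {k'} <;> simp [h1, h2, mul_comm]
      · intro m _ hm
        simp [hm]
      · simp
  -- From column `c` on the path is uncolored: `c` turns right out of its own column, and empty
  -- columns further left pass no color.
  have left : ∀ k, (c : ℕ) < k → k ≤ n →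
      pathSum (fun j r l => kWeight q x (extend 0 y j) l (extend ∅ V j) r (extend ∅ V' j)) k
        (some c) none = if ∀ j : Fin n, (j : ℕ) < k → V' j = (V j).erase c then
          ∏ j with j < c, (1 - x * (y j)⁻¹) else 0 := by
    intro k hk
    induction k, hk using Nat.le_induction with
    | base =>
      intro _
      have hforall : (∀ j : Fin n, (j : ℕ) < c + 1 → V' j = (V j).erase c) ↔
          (∀ j : Fin n, (j : ℕ) < c → V' j = (V j).erase c) ∧ V' c = ∅ := by
        have hVk : (V c).erase c = ∅ := by
          rw [hV, if_pos le_rfl]; simp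
        constructor
        · exact fun h => ⟨fun j hj => h j (by omega), by rw [h c (by omega), hVk]⟩
        · rintro ⟨h1, h2⟩ j hj
          by_cases hjk : j = c
          · rw [hjk, h2, hVk]
          · exact h1 j (lt_of_le_of_ne (Nat.lt_succ_iff.1 hj) fun h => hjk (Fin.ext h))
      simp only [pathSum, right c le_rfl, hS c, le_refl, if_true, extend_coe]
      rw [Finset.sum_eq_single (some c)]
      · rw [kWeight_none_singleton]
        simp only [hforall]
        by_cases h2 : V' c = ∅ <;> simp [h2]
      · intro m _ hm
        simp [hm]
      · simp
    | succ k hk ih =>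
      intro hkn
      set k' : Fin n := ⟨k, hkn⟩ with hk'
      have hkc : c < k' := hk
      have e0 := hS k'
      have e1 := extend_coe ∅ V' k'
      have e2 := extend_coe 0 y k'
      rw [if_neg hkc.not_ge] at e0
      simp only [hk'] at e0 e1 e2
      have hforall : (∀ j : Fin n, (j : ℕ) < k + 1 → V' j = (V j).erase c) ↔
          (∀ j : Fin n, (j : ℕ) < k → V' j = (V j).erase c) ∧ V' k' = ∅ := by
        have hVk : (V k').erase c = ∅ := by
          rw [hV, if_neg hkc.not_ge]; simp
        constructor
        · exact fun h => ⟨fun j hj => h j (by omega), by rw [h k' (by simp [hk']), hVk]⟩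
        · rintro ⟨h1, h2⟩ j hj
          by_cases hjk : j = k'
          · rw [hjk, h2, hVk]
          · exact h1 j (lt_of_le_of_ne (Nat.lt_succ_iff.1 hj) fun h => hjk (Fin.ext h))
      simp only [pathSum, e0, e1, e2, kWeight_none_empty]
      rw [Finset.sum_eq_single none]
      · rw [ih (by omega), ← hk']
        simp only [hforall]
        by_cases h2 : V' k' = ∅ <;> simp [h2]
      · intro m _ hm
        simp [hm]
      · simp
  rw [rowWeight, left n c.isLt le_rfl]
  simp

/-- Row `k` emits the color of the leftmost column still occupied, so the configuration is forced:
after `k` rows the columns `j` with `j + k < n` keep their own colors and the others are empty. -/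
theorem Zsq_rev (q : K) (x y : Fin n → K) :
    Zsq q 1 Fin.revPerm x y = ∏ i, ∏ j with j < Fin.rev i, (1 - x i * (y j)⁻¹) := by
  rw [Zsq_eq_pathSum]
  have key : ∀ k ≤ n, ∀ V, pathSum (transfer q x y Fin.revPerm) k (fun j => {j}) V =
      if V = (fun j : Fin n => if (j : ℕ) + k < n then {j} else ∅) then
        ∏ i ∈ Finset.univ.filter (fun i : Fin n => (i : ℕ) < k), ∏ j with j < Fin.rev i, (1 - x i * (y j)⁻¹) else 0 := by
    intro k
    induction k with
    | zero => intro _ V; simp [pathSum, eq_comm]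
    | succ k ih =>
      intro hk V
      set k' : Fin n := ⟨k, hk⟩ with hk'
      have hfil : (Finset.univ.filter fun j : Fin n => (j : ℕ) < k + 1)
          = insert k' (Finset.univ.filter fun j : Fin n => (j : ℕ) < k) := by
        ext j
        simp only [Finset.mem_filter, Finset.mem_univ, true_and, Finset.mem_insert, Fin.ext_iff, hk']
        omega
      have e1 := extend_coe 0 x k'
      have e2 := extend_coe none (fun i => some ((Fin.revPerm : Equiv.Perm (Fin n)) i)) k'
      simp only [hk'] at e1 e2
      simp only [pathSum, ih (by omega)]
      rw [Finset.sum_eq_single (fun j : Fin n => if (j : ℕ) + k < n then ({j} : Finset (Fin n)) else ∅)]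
      · rw [if_pos rfl, transfer, e1, e2, ← hk', Fin.revPerm_apply,
          rowWeight_straight q _ y (Fin.rev k') _ V, hfil, Finset.prod_insert (by simp [hk']),
          mul_comm, ite_mul, zero_mul]
        · refine if_congr ?_ rfl rfl
          rw [funext_iff]
          refine forall_congr' fun j => ?_
          suffices h : (if (j : ℕ) + k < n then ({j} : Finset (Fin n)) else ∅).erase (Fin.rev k')
              = if (j : ℕ) + (k + 1) < n then {j} else ∅ by rw [h]
          have hrev : (Fin.rev k' : ℕ) = n - (k + 1) := by simp [hk', Fin.val_rev]
          by_cases h1 : (j : ℕ) + (k + 1) < n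
          · rw [if_pos h1, if_pos (by omega), Finset.erase_eq_of_notMem]
            simp only [Finset.mem_singleton, Fin.ext_iff]
            omega
          · rw [if_neg h1]
            split_ifs with h2
            · have : j = Fin.rev k' := Fin.ext (by omega)
              rw [this]; simp
            · simp
        · intro j
          refine if_congr ?_ rfl rfl
          rw [Fin.le_def, Fin.val_rev]
          simp only [hk']
          omega
      · intro m _ hm
        rw [if_neg hm, zero_mul]
      · simp
  rw [key n le_rfl, if_pos]
  · simp
  · ext j; simp

end LongestElement

/-! ### The factors `φ_w` -/

section Phi

variable {n : ℕ} {K : Type*} [Field K]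

theorem phi_eq_prod (q : K) (y : Fin n → K) (w : Equiv.Perm (Fin n)) :
    phi q y w = ∏ p : Fin n × Fin n with p.1 < p.2,
      if w⁻¹ p.1 < w⁻¹ p.2 then q * (rootVal y p.1 p.2)⁻¹ - 1 else 1 - (rootVal y p.1 p.2)⁻¹ := by
  rw [phi, Finset.prod_ite, Finset.filter_filter, Finset.filter_filter]
  congr 2
  ext p
  simp only [Finset.mem_filter, Finset.mem_univ, true_and]
  refine and_congr_right fun h => ?_
  rw [not_lt]
  exact ⟨le_of_lt, fun h' => lt_of_le_of_ne h' fun h'' => h.ne' (w⁻¹.injective h'')⟩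

theorem phi_rev (q : K) (y : Fin n → K) :
    phi q y Fin.revPerm = ∏ i, ∏ j with j < Fin.rev i, (1 - y (Fin.rev i) * (y j)⁻¹) := by
  rw [phi_eq_prod, Finset.prod_filter, Fintype.prod_prod_type, Finset.prod_comm,
    ← Equiv.prod_comp Fin.revPerm]
  refine Finset.prod_congr rfl fun i _ => ?_
  rw [Finset.prod_filter]
  refine Finset.prod_congr rfl fun j _ => ?_
  simp only [Fin.revPerm_apply]
  refine if_ctx_congr Iff.rfl (fun h => ?_) fun _ => rfl
  rw [if_neg]
  · rw [rootVal, inv_div, div_eq_mul_inv]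
  · have : (Fin.revPerm : Equiv.Perm (Fin n))⁻¹ = Fin.revPerm := rfl
    rw [this, Fin.revPerm_apply, Fin.revPerm_apply, Fin.rev_lt_rev]
    exact h.not_gt

theorem phi_ne_zero {q : K} {y : Fin n → K} (hy0 : ∀ i, y i ≠ 0) (hy : Function.Injective y)
    (hq : ∀ i j : Fin n, i < j → q * y j ≠ y i) (w : Equiv.Perm (Fin n)) : phi q y w ≠ 0 := by
  rw [phi_eq_prod, Finset.prod_ne_zero_iff]
  intro p hp
  simp only [Finset.mem_filter, Finset.mem_univ, true_and] at hp
  rw [rootVal, inv_div]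
  split_ifs
  · rw [← mul_div_assoc, sub_ne_zero, Ne, div_eq_one_iff_eq (hy0 _)]
    exact hq _ _ hp
  · rw [sub_ne_zero, ne_comm, Ne, div_eq_one_iff_eq (hy0 _)]
    exact fun h => hp.ne' (hy h)

/-- Only the pair `{v(i), v(i+1)}` changes its type; the common factor `P` is the product over all
other positive roots. -/
theorem phi_mul_simpleRefl (q : K) (y : Fin n → K) (v : Equiv.Perm (Fin n)) (i : Fin (n - 1))
    (h : v (hi i) < v (lo i)) : ∃ P, phi q y v = P * (1 - y (v (lo i)) / y (v (hi i)))
      ∧ phi q y (v * simpleRefl i) = P * (q * (y (v (lo i)) / y (v (hi i))) - 1) := by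
  have hmem : (v (hi i), v (lo i)) ∈ Finset.univ.filter fun p : Fin n × Fin n => p.1 < p.2 := by
    simpa using h
  have hinv : ∀ k, (v * simpleRefl i)⁻¹ k = simpleRefl i (v⁻¹ k) := fun k => by
    rw [mul_inv_rev, simpleRefl_inv, Equiv.Perm.mul_apply]
  refine ⟨∏ p ∈ (Finset.univ.filter fun p : Fin n × Fin n => p.1 < p.2).erase (v (hi i), v (lo i)),
    if v⁻¹ p.1 < v⁻¹ p.2 then q * (rootVal y p.1 p.2)⁻¹ - 1 else 1 - (rootVal y p.1 p.2)⁻¹, ?_, ?_⟩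
  · rw [phi_eq_prod, ← Finset.prod_erase_mul _ _ hmem]
    simp [(lo_lt_hi i).not_gt, rootVal]
  · rw [phi_eq_prod, ← Finset.prod_erase_mul _ _ hmem]
    congr 1
    · refine Finset.prod_congr rfl fun p hp => if_congr ?_ rfl rfl
      simp only [Finset.mem_erase, Finset.mem_filter, Finset.mem_univ, true_and] at hp
      rw [hinv, hinv, simpleRefl_lt_iff]
      · rintro ⟨h1, h2⟩
        rw [Equiv.Perm.inv_eq_iff_eq] at h1 h2
        exact hp.2.not_gt (by rw [h1, h2]; exact h)
      · rintro ⟨h1, h2⟩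
        rw [Equiv.Perm.inv_eq_iff_eq] at h1 h2
        exact hp.1 (Prod.ext h1 h2)
    · have h1 : ∀ k, v⁻¹ (v k) = k := fun k => by simp
      simp only [hinv, h1, simpleRefl_lo, simpleRefl_hi, lo_lt_hi, if_true,
        rootVal, inv_div]

end Phi

/-! ### Comparison of the restricted partition functions with `Θ` -/

section Restriction

variable {n : ℕ} {K : Type*} [Field K]

theorem theta_relation (q : K) {y : Fin n → K} (hy0 : ∀ i, y i ≠ 0) (hy : Function.Injective y)
    (u v : Equiv.Perm (Fin n)) (i : Fin (n - 1)) (hu : u (hi i) < u (lo i)) :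
    (y (v (hi i)) - q * y (v (lo i))) * theta q y u v
      = (1 - q) * y (v (lo i)) * theta q y u (v * simpleRefl i)
        + (y (v (lo i)) - y (v (hi i))) * theta q y (u * simpleRefl i) (v * simpleRefl i) := by
  have hr := isBumpNakasuji_rPoly q hy0 hy
  have hinv : ∀ w : Equiv.Perm (Fin n), (w * simpleRefl i)⁻¹ = simpleRefl i * w⁻¹ := fun w => by
    rw [mul_inv_rev, simpleRefl_inv]
  have hlen : len (simpleRefl i * u⁻¹) < len u⁻¹ :=
    len_gt_of_inv_gt i _ (by simpa using hu)
  have yl := hy0 (v (lo i))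
  have yh := hy0 (v (hi i))
  have hne : y (v (lo i)) ≠ y (v (hi i)) := fun h => lo_ne_hi i (v.injective (hy h))
  have hlh : y (v (lo i)) - y (v (hi i)) ≠ 0 := sub_ne_zero.2 hne
  have hhl : y (v (hi i)) - y (v (lo i)) ≠ 0 := sub_ne_zero.2 hne.symm
  simp only [theta, hinv]
  -- If `v(i) < v(i+1)`, then `s v⁻¹` has the descent and both terms on the right are expanded;
  -- otherwise `v⁻¹` has it and only the left side is.
  rcases lt_or_gt_of_ne (v.injective.ne (lo_ne_hi i)) with hv | hv
  · obtain ⟨P, h1, h2⟩ := phi_mul_simpleRefl q y (v * simpleRefl i) i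
      (by simpa [simpleRefl_lo, simpleRefl_hi] using hv)
    rw [mul_assoc, simpleRefl_mul_self, mul_one] at h2
    simp only [Equiv.Perm.mul_apply, simpleRefl_lo, simpleRefl_hi] at h1 h2
    have hlen' : len (simpleRefl i * (simpleRefl i * v⁻¹)) < len (simpleRefl i * v⁻¹) := by
      rw [simpleRefl_mul_cancel]
      exact len_lt_of_inv_lt i _ (by simpa using hv)
    have r1 := hr.rec_descent u⁻¹ _ i hlen' hlen
    have r2 := hr.rec_ascent (simpleRefl i * u⁻¹) _ i hlen' (by rwa [simpleRefl_mul_cancel])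
    have hb : betaVal y (simpleRefl i * v⁻¹) i = y (v (lo i)) / y (v (hi i)) := by
      rw [betaVal, rootVal, inv_simpleRefl_mul, inv_simpleRefl_mul, simpleRefl_lo, simpleRefl_hi,
        inv_inv]
    rw [simpleRefl_mul_cancel, hb] at r1 r2
    rw [simpleRefl_mul_cancel] at r2
    have hb1 : 1 - y (v (lo i)) / y (v (hi i)) ≠ 0 := by
      rw [sub_ne_zero, ne_comm, Ne, div_eq_one_iff_eq yh]; exact hne
    rw [h1, h2, r2, r1]
    field_simp
    ring
  · obtain ⟨P, h1, h2⟩ := phi_mul_simpleRefl q y v i hv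
    have hlen' : len (simpleRefl i * v⁻¹) < len v⁻¹ := len_gt_of_inv_gt i _ (by simpa using hv)
    have r1 := hr.rec_descent u⁻¹ _ i hlen' hlen
    have hb : betaVal y v⁻¹ i = y (v (hi i)) / y (v (lo i)) := by
      rw [betaVal, rootVal, inv_inv]
    rw [hb] at r1
    have hb1 : 1 - y (v (hi i)) / y (v (lo i)) ≠ 0 := by
      rw [sub_ne_zero, ne_comm, Ne, div_eq_one_iff_eq yl]; exact hne.symm
    rw [h1, h2, r1]
    field_simp
    ring

theorem restrict_Zsq_rev (q : K) {y : Fin n → K} (hy0 : ∀ i, y i ≠ 0) (v : Equiv.Perm (Fin n)) :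
    restrict (Zsq q 1 Fin.revPerm) v y = theta q y Fin.revPerm v := by
  have hrev : (Fin.revPerm : Equiv.Perm (Fin n))⁻¹ = Fin.revPerm := rfl
  rw [restrict, Zsq_rev, theta, hrev]
  by_cases hv : v = Fin.revPerm
  · subst hv
    rw [phi_rev, hrev, rPoly_diag, mul_one]
    rfl
  · have h1 : rPoly q y Fin.revPerm v⁻¹ = 0 := by
      by_contra h
      rcases (rPoly_vanish q y _ _ h).eq_or_len_lt with h' | h'
      · exact hv (by rw [← hrev, h', inv_inv])
      · exact absurd h' (len_le_len_rev _).not_gt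
    -- Otherwise `v` dominates the reversal pointwise; both have the same sum of values, so they
    -- would coincide.
    have h2 : ∃ i, v i < Fin.rev i := by
      by_contra! hcon
      refine hv (Equiv.ext fun i => Fin.ext ?_)
      have hsum : ∑ i : Fin n, ((Fin.rev i : Fin n) : ℕ) = ∑ i, (v i : ℕ) := by
        have h1 : ∑ i, (v i).val = ∑ i : Fin n, i.val := Equiv.sum_comp v Fin.val
        have h2 : ∑ i : Fin n, (Fin.rev i).val = ∑ i : Fin n, i.val :=
          Equiv.sum_comp Fin.revPerm Fin.val
        exact h2.trans h1.symm
      exact ((Finset.sum_eq_sum_iff_of_le fun i _ => Fin.le_def.1 (hcon i)).1 hsum i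
        (Finset.mem_univ i)).symm
    obtain ⟨i, hi⟩ := h2
    rw [h1, mul_zero]
    -- The factor with `j = v i` is `1 - y_j / y_j`.
    refine Finset.prod_eq_zero (Finset.mem_univ i) (Finset.prod_eq_zero (i := v i) (by simpa using hi) ?_)
    rw [mul_inv_cancel₀ (hy0 _), sub_self]

theorem restrict_Zsq (q : K) {y : Fin n → K} (hy0 : ∀ i, y i ≠ 0) (hy : Function.Injective y)
    (u v : Equiv.Perm (Fin n)) : restrict (Zsq q 1 u) v y = theta q y u v := by
  have ascent : ∀ u : Equiv.Perm (Fin n), u = Fin.revPerm ∨ ∃ i, u (lo i) < u (hi i) := by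
    intro u
    by_cases h : ∃ i, u (lo i) < u (hi i)
    · exact Or.inr h
    · refine Or.inl (eq_rev_of_forall_lt u fun i => ?_)
      exact lt_of_le_of_ne (not_lt.1 (not_exists.1 h i)) fun h' => lo_ne_hi i (u.injective h').symm
  -- Induction on a bound `k` for the colength of `u⁻¹`; an ascent of `u` lowers the colength, for
  -- all `v` at once.
  have key : ∀ k, ∀ u v : Equiv.Perm (Fin n), len (Fin.revPerm : Equiv.Perm (Fin n)) ≤ len u⁻¹ + k →
      restrict (Zsq q 1 u) v y = theta q y u v := by
    intro k
    induction k with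
    | zero =>
      intro u v hu
      rcases ascent u with rfl | ⟨i, hi⟩
      · exact restrict_Zsq_rev q hy0 v
      · exact absurd ((len_lt_of_inv_lt i u⁻¹ (by simpa using hi)).trans_le (len_le_len_rev _))
          hu.not_gt
    | succ k ih =>
      intro u v hu
      rcases ascent u with rfl | ⟨i, hi⟩
      · exact restrict_Zsq_rev q hy0 v
      have hlen := len_lt_of_inv_lt i u⁻¹ (by simpa using hi)
      have ih' : ∀ v, restrict (Zsq q 1 (u * simpleRefl i)) v y
          = theta q y (u * simpleRefl i) v := fun v => ih _ v (by
        rw [mul_inv_rev, simpleRefl_inv]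
        omega)
      have hdesc : (u * simpleRefl i) (ColoredLattice.hi i) < (u * simpleRefl i) (lo i) := by
        simpa only [Equiv.Perm.mul_apply, simpleRefl_lo, simpleRefl_hi] using hi
      -- Starting at `(us, vs)` puts the unknown pair `(u, v)` in the last term, whose coefficient
      -- is invertible; the other terms belong to `us`. No division by `φ` occurs, so no condition
      -- on `q` is needed.
      have h1 := theta_relation q hy0 hy (u * simpleRefl i) (v * simpleRefl i) i hdesc
      have h2 := Zsq_relation q (fun k => y ((v * simpleRefl i) k)) y (u * simpleRefl i) i hdesc
      have hv : ∀ k, (v * simpleRefl i) (simpleRefl i k) = v k := fun k => by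
        rw [← Equiv.Perm.mul_apply, mul_assoc, simpleRefl_mul_self, mul_one]
      have hy' : y ((v * simpleRefl i) (lo i)) - y ((v * simpleRefl i) (ColoredLattice.hi i)) ≠ 0 :=
        sub_ne_zero.2 fun h => lo_ne_hi i ((v * simpleRefl i).injective (hy h))
      simp only [hv, mul_assoc u, mul_assoc v, simpleRefl_mul_self, mul_one] at h1 h2
      have e1 := ih' (v * simpleRefl i)
      have e2 := ih' v
      unfold restrict at e1 e2 ⊢
      rw [e1, e2, h1] at h2
      exact (mul_left_cancel₀ hy' (add_left_cancel h2)).symm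
  exact key _ u v (Nat.le_add_left _ _)

end Restriction

/-! ### Weights in terms of roots, and the main theorem -/

theorem kWeight_eq_rWeight {n : ℕ} {K : Type*} [Field K] (q x y : K) (l : Option (Fin n))
    (S : Finset (Fin n)) (r : Option (Fin n)) (B : Finset (Fin n)) :
    kWeight q x y l S r B = rWeight q (x / y) l S r B := by
  unfold kWeight rWeight
  simp only [div_eq_mul_inv]

end ColoredLattice

theorem proposition7p9 (n : ℕ) {K : Type*} [Field K] (q : K) (y : Fin n → K)
    (hy0 : ∀ i, y i ≠ 0) (hy : Function.Injective y) :
    -- the functions `r_{u,v}` are the unique family with the Bump–Nakasuji properties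
    (IsBumpNakasuji q y (rPoly q y) ∧ ∀ r, IsBumpNakasuji q y r → r = rPoly q y) ∧
    -- restricted partition functions
    (∀ u v : Equiv.Perm (Fin n), restrict (Zsq q 1 u) v y = theta q y u v) ∧
    -- the functions `r_{u,v}` as restricted partition functions
    ((∀ i j : Fin n, i < j → q * y j ≠ y i) → ∀ u v : Equiv.Perm (Fin n),
      phi q y v⁻¹ ≠ 0 ∧
      rPoly q y u v = (phi q y v⁻¹)⁻¹ * restrict (Zsq q 1 u⁻¹) v⁻¹ y) ∧
    -- the Boltzmann weights of the lattice model `Z_{1, u⁻¹} |_{v⁻¹}`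
    (∀ u v : Equiv.Perm (Fin n),
      (∀ (i j : Fin n) (l : Option (Fin n)) (S : Finset (Fin n)) (r : Option (Fin n))
        (B : Finset (Fin n)),
        kWeight q (y (v⁻¹ i)) (y j) l S r B = rWeight q (rootVal y (v⁻¹ i) j) l S r B) ∧
      restrict (Zsq q 1 u⁻¹) v⁻¹ y =
        partitionFunction (fun i j => rWeight q (rootVal y (v⁻¹ i) j)) 1 u⁻¹) := by
  refine ⟨⟨isBumpNakasuji_rPoly q hy0 hy, fun r hr => hr.unique (isBumpNakasuji_rPoly q hy0 hy)⟩,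
    restrict_Zsq q hy0 hy, fun hq u v => ?_, fun u v => ⟨fun i j l S r B =>
      kWeight_eq_rWeight q _ _ l S r B, ?_⟩⟩
  · have h := phi_ne_zero hy0 hy hq v⁻¹
    refine ⟨h, ?_⟩
    rw [restrict_Zsq q hy0 hy, theta, inv_inv, inv_inv, inv_mul_cancel_left₀ h]
  · have h : ∀ x y : K, kWeight (n := n) q x y = rWeight q (x / y) := fun x y => by
      ext l S r B
      exact kWeight_eq_rWeight q x y l S r B
    simp only [restrict, Zsq, rootVal, h]
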